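/- All graphs are finite and simple. In the Cops and Robber game on $G$ with a robber of unbounded speed, $k$ cops first choose starting vertices, then the robber chooses hers; afterwards, in each round, first every cop stays or moves to an adjacent vertex, and then the robber moves along any path of $G$ none of whose vertices is occupied by a cop (she may also stay). The cops win if after finitely many moves a cop is at the robber's vertex. The cop number $c_\infty(G)$ is the least $k$ such that $k$ cops can force a win. A graph is an interval graph if it is the intersection graph of a family of closed intervals of the real line. Let $G$ be a connected interval graph, and let $(I_v)_{v\in V(G)}$ be closed intervals of positive length whose intersection graph is $G$. Let $x_1<\dots<x_{l+1}$ be the distinct endpoints of these intervals, let $x_i<y_i<x_{i+1}$, put $V_i=\{v: y_i\in I_v\}$ for $1\le i\le l$, and for $1\le a\le b\le l$ let $G[a,b]$ be the subgraph of $G$ induced by $\bigcup_{a\le i\le b}V_i$. A subgraph $H$ of $G$ is called $k$-wide if $H$ is $k$-connected and no set $S\subseteq V(G)$ with $|S|<k$ satisfies $V(H)\subseteq S\cup N(S)$. Here $k$-connected means that $H$ has more than $k$ vertices and stays connected after the deletion of any fewer than $k$ vertices, with the convention that the one-vertex graph is $1$-connected. Let $w(G)$ be the maximum $M$ such that some $G[a,b]$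 is $M$-wide. **Theorem.** Every connected interval graph $G$ is the intersection graph of a family of closed intervals of positive length, and for every such representation $$w(G)\le c_\infty(G)\le 3\,w(G).$$ Moreover there is an algorithm (a program for a random access machine with addition and truncated subtraction, each elementary operation costing one step) which, given the adjacency matrix of a connected interval graph $G$ on $n$ vertices, halts within a number of steps polynomial in $n$ and outputs $3\,w(G)$, whichever representation is used to define $w(G)$. Its output $A(G)$ thus satisfies $c_\infty(G)\le A(G)\le 3\,c_\infty(G)$; that is, there is a polynomial-time $3$-approximation algorithm for computing $c_\infty(G)$ for interval graphs. -/

import Mathlib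

/-! ## The Cops and Robber game with a robber of unbounded speed -/

namespace InfiniteSpeed

/-- A position `r'` can be reached by the robber in one turn from `r` while the cops occupy the
vertices in `S`: there is a walk from `r` to `r'` no vertex of which is occupied by a cop
(so she may also stay, and she has no move at all if a cop is at `r`). -/
def RobberMove {V : Type*} (G : SimpleGraph V) (S : Set V) (r r' : V) : Prop :=
  ∃ p : G.Walk r r', ∀ v ∈ p.support, v ∉ S

/-- In one turn of the cops, each cop stays where it is or moves along one edge. -/
def CopMove {V : Type*} (G : SimpleGraph V) {k : ℕ} (C C' : Fin k → V) : Prop :=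
  ∀ i, C' i = C i ∨ G.Adj (C i) (C' i)

/-- `WinFrom G C r`: with the cops at `C`, the robber at `r` and the cops to move,
`k` cops can force the capture of the robber after finitely many rounds. -/
inductive WinFrom {V : Type*} (G : SimpleGraph V) {k : ℕ} : (Fin k → V) → V → Prop
  | captured (C : Fin k → V) (r : V) (i : Fin k) (h : C i = r) : WinFrom G C r
  | move (C : Fin k → V) (r : V) (C' : Fin k → V) (hC : CopMove G C C')
      (h : ∀ r', RobberMove G (Set.range C') r r' → WinFrom G C' r') : WinFrom G C r

/-- `k` cops win on `G`: they can choose starting vertices such that, wherever the robber then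
starts, they can force her capture. -/
def CopsWin {V : Type*} (G : SimpleGraph V) (k : ℕ) : Prop :=
  ∃ C : Fin k → V, ∀ r : V, WinFrom G C r

/-- The cop number of `G` against a robber of unbounded speed. -/
noncomputable def copNumber {V : Type*} (G : SimpleGraph V) : ℕ :=
  sInf {k | CopsWin G k}

/-- On a finite graph the cop number is a genuine minimum. -/
theorem isLeast_copNumber {V : Type*} [Fintype V] (G : SimpleGraph V) :
    IsLeast {k | CopsWin G k} (copNumber G) := by
  have hne : {k | CopsWin G k}.Nonempty :=
    ⟨Fintype.card V, (Fintype.equivFin V).symm, fun r =>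
      WinFrom.captured _ r (Fintype.equivFin V r) (by simp)⟩
  exact ⟨Nat.sInf_mem hne, fun k hk => Nat.sInf_le hk⟩

/-! ## Wide subgraphs -/

/-- `G` is `k`-connected: deleting fewer than `k` vertices always leaves a connected graph, and
`G` has more than `k` vertices (with the convention that the graph with a single vertex is
`1`-connected). -/
def IsKConnected {W : Type*} (G : SimpleGraph W) (k : ℕ) : Prop :=
  (k ≤ 1 ∨ k < Nat.card W) ∧
    ∀ X : Finset W, X.card < k → (G.induce ((X : Set W)ᶜ)).Connected

/-- The closed neighbourhood of a set of vertices. -/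
def closedNbhd {V : Type*} (G : SimpleGraph V) (S : Set V) : Set V :=
  {v | v ∈ S ∨ ∃ s ∈ S, G.Adj s v}

/-- The subgraph of `G` induced by `A` is `k`-wide in `G`. -/
def IsWide {V : Type*} (G : SimpleGraph V) (k : ℕ) (A : Set V) : Prop :=
  IsKConnected (G.induce A) k ∧
    ∀ S : Finset V, S.card < k → ¬ A ⊆ closedNbhd G (S : Set V)

/-! ## Interval graphs -/

/-- `G` is the intersection graph of a family of (possibly degenerate) nonempty closed
intervals of the real line. -/
def IsIntervalGraph {V : Type*} (G : SimpleGraph V) : Prop :=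
  ∃ lo hi : V → ℝ, (∀ v, lo v ≤ hi v) ∧
    ∀ u v, u ≠ v →
      (G.Adj u v ↔ (Set.Icc (lo u) (hi u) ∩ Set.Icc (lo v) (hi v)).Nonempty)

/-- A representation of `G` as the intersection graph of closed intervals of positive length. -/
structure IntervalRep {V : Type*} (G : SimpleGraph V) where
  lo : V → ℝ
  hi : V → ℝ
  lo_lt_hi : ∀ v, lo v < hi v
  adj_iff : ∀ u v, u ≠ v →
    (G.Adj u v ↔ (Set.Icc (lo u) (hi u) ∩ Set.Icc (lo v) (hi v)).Nonempty)

namespace IntervalRep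

variable {V : Type*} [Fintype V] {G : SimpleGraph V}

/-- The set `{x₁ < x₂ < ⋯ < x_{l+1}}` of distinct endpoints. -/
noncomputable def endpoints (R : IntervalRep G) : Finset ℝ :=
  Finset.univ.image R.lo ∪ Finset.univ.image R.hi

/-- The number `l` of gaps between consecutive endpoints. -/
noncomputable def numGaps (R : IntervalRep G) : ℕ := R.endpoints.card - 1

/-- The endpoints in increasing order. -/
noncomputable def endpoint (R : IntervalRep G) (i : Fin R.endpoints.card) : ℝ :=
  R.endpoints.orderEmbOfFin rfl i

/-- A point `yᵢ` strictly between the consecutive endpoints `xᵢ` and `xᵢ₊₁` (the midpoint). -/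
noncomputable def gapPoint (R : IntervalRep G) (i : Fin R.numGaps) : ℝ :=
  (R.endpoint ⟨i, Nat.lt_of_lt_pred i.isLt⟩ +
    R.endpoint ⟨i + 1, Nat.add_lt_of_lt_sub i.isLt⟩) / 2

/-- `Vᵢ`, the set of the vertices whose interval contains `yᵢ`. -/
def bag (R : IntervalRep G) (i : Fin R.numGaps) : Set V :=
  {v | R.gapPoint i ∈ Set.Icc (R.lo v) (R.hi v)}

/-- The vertex set `⋃_{a ≤ i ≤ b} Vᵢ` of the interval subgraph `G[a,b]`. -/
def interval (R : IntervalRep G) (a b : Fin R.numGaps) : Set V :=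
  ⋃ i ∈ Set.Icc a b, R.bag i

/-- `w(G)` (with respect to the given representation): the maximum number `M` such that some
interval subgraph `G[a,b]` is `M`-wide. -/
noncomputable def w (R : IntervalRep G) : ℕ :=
  sSup {M | ∃ a b : Fin R.numGaps, a ≤ b ∧ IsWide G M (R.interval a b)}

/-- On a nonempty finite graph the maximum in the definition of `w` is attained. -/
theorem isGreatest_w [Nonempty V] (R : IntervalRep G) :
    IsGreatest {M | ∃ a b : Fin R.numGaps, a ≤ b ∧ IsWide G M (R.interval a b)} R.w := by
  have hne : {M | ∃ a b : Fin R.numGaps, a ≤ b ∧ IsWide G M (R.interval a b)}.Nonempty := by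
    obtain ⟨v⟩ := ‹Nonempty V›
    have hlo : R.lo v ∈ R.endpoints := by simp [endpoints]
    have hhi : R.hi v ∈ R.endpoints := by simp [endpoints]
    have hcard : 1 < R.endpoints.card :=
      Finset.one_lt_card.2 ⟨_, hlo, _, hhi, (R.lo_lt_hi v).ne⟩
    have h0 : 0 < R.numGaps := Nat.sub_pos_of_lt hcard
    exact ⟨0, ⟨0, h0⟩, ⟨0, h0⟩, le_rfl, ⟨Or.inl (Nat.zero_le _), fun X hX => absurd hX (by simp)⟩,
      fun S hS => absurd hS (by simp)⟩
  have hb : BddAbove {M | ∃ a b : Fin R.numGaps, a ≤ b ∧ IsWide G M (R.interval a b)} := by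
    refine ⟨Fintype.card V, ?_⟩
    rintro M ⟨a, b, -, -, h⟩
    by_contra hM
    exact h Finset.univ (by simpa using hM) (fun v _ => Or.inl (by simp))
  exact ⟨Nat.sSup_mem hne hb, fun M hM => le_csSup hb hM⟩

end IntervalRep

/-! ## Random access machine programs with a step count

The data are natural numbers, held in registers and in an addressable memory. The arithmetic
operations are addition and truncated subtraction only, and every elementary operation costs
one step. Since one operation lengthens the binary length of the largest number by at most one,
polynomial time in this model is polynomial time on Turing machines. -/

/-- The state of the machine: registers and memory cells. -/
structure State where
  reg : ℕ → ℕ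
  mem : ℕ → ℕ

/-- Arithmetic expressions: constants, registers, memory cells with a computed address,
sums and truncated differences. -/
inductive Expr
  | const (c : ℕ)
  | reg (r : ℕ)
  | mem (a : Expr)
  | add (e f : Expr)
  | sub (e f : Expr)

namespace Expr

/-- The value of an expression. -/
def eval (s : State) : Expr → ℕ
  | const c => c
  | reg r => s.reg r
  | mem a => s.mem (eval s a)
  | add e f => eval s e + eval s f
  | sub e f => eval s e - eval s f

/-- The number of steps taken to evaluate an expression: one for each of its nodes. -/
def cost : Expr → ℕ
  | const _ => 1
  | reg _ => 1
  | mem a => cost a + 1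
  | add e f => cost e + cost f + 1
  | sub e f => cost e + cost f + 1

end Expr

/-- Programs: assignment to a register, assignment to a memory cell with a computed address,
sequencing, branching and looping on whether an expression is nonzero. -/
inductive Prog
  | skip
  | set (r : ℕ) (e : Expr)
  | store (a e : Expr)
  | seq (P Q : Prog)
  | cond (e : Expr) (P Q : Prog)
  | loop (e : Expr) (P : Prog)

/-- `Exec P s t s'`: started in state `s`, the program `P` halts after exactly `t` steps, in
state `s'`. -/
inductive Exec : Prog → State → ℕ → State → Prop
  | skip (s : State) : Exec Prog.skip s 1 s
  | set (s : State) (r : ℕ) (e : Expr) :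
      Exec (Prog.set r e) s (e.cost + 1) { s with reg := Function.update s.reg r (e.eval s) }
  | store (s : State) (a e : Expr) :
      Exec (Prog.store a e) s (a.cost + e.cost + 1)
        { s with mem := Function.update s.mem (a.eval s) (e.eval s) }
  | seq {P Q : Prog} {s₁ s₂ s₃ : State} {t u : ℕ} (hP : Exec P s₁ t s₂) (hQ : Exec Q s₂ u s₃) :
      Exec (Prog.seq P Q) s₁ (t + u) s₃
  | cond_pos {e : Expr} {P Q : Prog} {s s' : State} {t : ℕ} (he : e.eval s ≠ 0)
      (hP : Exec P s t s') : Exec (Prog.cond e P Q) s (e.cost + 1 + t) s'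
  | cond_zero {e : Expr} {P Q : Prog} {s s' : State} {t : ℕ} (he : e.eval s = 0)
      (hQ : Exec Q s t s') : Exec (Prog.cond e P Q) s (e.cost + 1 + t) s'
  | loop_zero {e : Expr} {P : Prog} {s : State} (he : e.eval s = 0) :
      Exec (Prog.loop e P) s (e.cost + 1) s
  | loop_pos {e : Expr} {P : Prog} {s₁ s₂ s₃ : State} {t u : ℕ} (he : e.eval s₁ ≠ 0)
      (hP : Exec P s₁ t s₂) (hL : Exec (Prog.loop e P) s₂ u s₃) :
      Exec (Prog.loop e P) s₁ (e.cost + 1 + t + u) s₃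

open Classical in
/-- The initial state for a graph `G` on `{0, …, n - 1}`: register `0` holds `n`, memory cell
`i * n + j` (for `i, j < n`) holds `1` if `i` and `j` are adjacent, and everything else is `0`. -/
noncomputable def graphInput {n : ℕ} (G : SimpleGraph (Fin n)) : State where
  reg := fun r => if r = 0 then n else 0
  mem := fun k => if ∃ i j : Fin n, k = (i : ℕ) * n + (j : ℕ) ∧ G.Adj i j then 1 else 0

/-- Given the adjacency matrix of `G`, the program `P` halts after at most `t` steps with the
output `out` in register `0`. -/
def OutputsWithin {n : ℕ} (P : Prog) (G : SimpleGraph (Fin n)) (out t : ℕ) : Prop :=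
  ∃ (t' : ℕ) (s : State), t' ≤ t ∧ Exec P (graphInput G) t' s ∧ s.reg 0 = out

end InfiniteSpeed

namespace InfiniteSpeed

open Set

/-! Everything rests on the fact that the width depends on `G` alone: `M ≤ R.w` if and only if some
set of vertices is `M`-wide (`le_w_iff`). Let `A` be `M`-wide with `M ≥ 2`, let `u` be the member
whose interval ends first and `v` the one whose interval begins last. These intervals are disjoint,
since otherwise one vertex dominates `A`. A point strictly between them lies in at least `M`
intervals, since otherwise its bag separates `u` from `v` in `A`. Large bags between `hi u` and `lo
v` make the set of all vertices meeting `[hi u, lo v]` `M`-wide (`isWide_of_bags`); it contains `A`,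
and it is some `G[a,b]`.

Lower bound: against fewer than `M` cops, the robber waits at a vertex of an `M`-wide set that no
cop dominates. The cops' next turn cannot catch her, and the set minus the cops is connected, so she
runs to a vertex that the new positions do not dominate.

Upper bound: three groups of `w` cops sweep from left to right (`winFrom_of_guard`). One group
occupies the bag of a point `y` to the left of the robber, the second moves to the next bag of size
at most `w`, and if the robber is caught in between, the third occupies a dominating set of the
pocket. It has at most `w` vertices, since all bags inside the pocket are larger than `w` and no set
is `(w + 1)`-wide (`exists_dominating`).

Algorithm: the width must be found without a representation. A small bag between two vertices
contains a bag that is the common neighbourhood of two non-adjacent vertices, so quadratically many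
separators suffice, and an `M`-wide set exists exactly if the block of some non-adjacent pair is not
dominated by fewer than `M` vertices (`exists_isWide_iff`). Domination numbers are computed greedily
and certified by packings (`le_ncard_greedy_iff`). The computation is written as a term of a small
language in which every term compiles to a polynomial-time program (`runs_comp`). -/

theorem IsWide.mono {V : Type*} {G : SimpleGraph V} {A : Set V} {k m : ℕ} (h : IsWide G k A)
    (hm : m ≤ k) : IsWide G m A :=
  ⟨⟨h.1.1.imp (hm.trans) (lt_of_le_of_lt hm), fun X hX => h.1.2 X (hX.trans_le hm)⟩,
    fun S hS => h.2 S (hS.trans_le hm)⟩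

/-- A property preserved along the edges is preserved along walks. -/
theorem reachable_induction {V : Type*} {G : SimpleGraph V} {P : V → Prop}
    (hP : ∀ u v, G.Adj u v → P u → P v) {u v : V} (h : G.Reachable u v) (hu : P u) : P v := by
  obtain ⟨p⟩ := h
  induction p with
  | nil => exact hu
  | cons hadj _ ih => exact ih (hP _ _ hadj hu)

section Linked

variable {V : Type*} {G : SimpleGraph V}

/-- There is a walk from `x` to `y` whose vertices after the first are not in `X`. -/
def Linked (G : SimpleGraph V) (X : Set V) : V → V → Prop :=
  Relation.ReflTransGen fun c d => G.Adj c d ∧ d ∉ X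

theorem IsWide.linked [Finite V] {A : Set V} {M : ℕ} (h : IsWide G M A) {X : Set V}
    (hX : X.ncard < M) {x y : V} (hx : x ∈ A) (hy : y ∈ A) (hxX : x ∉ X) (hyX : y ∉ X) :
    Linked G X x y := by
  classical
  have hfin : {x : A | (x : V) ∈ X}.Finite := Set.toFinite _
  have hconn := h.1.2 hfin.toFinset (by
    rw [← Set.ncard_eq_toFinset_card _ hfin]
    refine lt_of_le_of_lt ?_ hX
    exact Set.ncard_le_ncard_of_injOn (fun x => x.1) (fun x hx => hx)
      (fun x _ y _ hxy => Subtype.ext hxy) (Set.toFinite _))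
  have hreach := hconn.preconnected ⟨⟨x, hx⟩, by simpa using hxX⟩ ⟨⟨y, hy⟩, by simpa using hyX⟩
  refine reachable_induction (P := fun c : ((hfin.toFinset : Set A)ᶜ : Set A) => Linked G X x c.1.1)
    (fun c d hcd hc => ?_) hreach
    Relation.ReflTransGen.refl
  exact hc.tail ⟨hcd, by simpa using d.2⟩

theorem Linked.induction {X : Set V} {P : V → Prop}
    (hP : ∀ u v, G.Adj u v → v ∉ X → P u → P v) {x y : V} (h : Linked G X x y) (hx : P x) :
    P y := by
  induction h with
  | refl => exact hx
  | tail _ h ih => exact hP _ _ h.1 h.2 ih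

end Linked

/-! ### Connectivity, domination and wide sets in an interval representation -/

namespace IntervalRep

variable {V : Type*} {G : SimpleGraph V}

theorem adj_iff_le (R : IntervalRep G) {u v : V} (h : u ≠ v) :
    G.Adj u v ↔ R.lo u ≤ R.hi v ∧ R.lo v ≤ R.hi u := by
  rw [R.adj_iff u v h]
  have hu := (R.lo_lt_hi u).le
  have hv := (R.lo_lt_hi v).le
  constructor
  · rintro ⟨x, ⟨h1, h2⟩, h3, h4⟩
    exact ⟨h1.trans h4, h3.trans h2⟩
  · rintro ⟨h1, h2⟩
    rcases le_total (R.lo u) (R.lo v) with h | h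
    · exact ⟨R.lo v, ⟨h, h2⟩, le_rfl, hv⟩
    · exact ⟨R.lo u, ⟨le_rfl, hu⟩, h, h1⟩

theorem le_of_adj (R : IntervalRep G) {u v : V} (h : G.Adj u v) : R.lo u ≤ R.hi v :=
  ((R.adj_iff_le h.ne).1 h).1

theorem eq_or_adj (R : IntervalRep G) {u v : V} (h : R.lo u ≤ R.hi v) (h' : R.lo v ≤ R.hi u) :
    u = v ∨ G.Adj u v := by
  by_cases huv : u = v
  · exact Or.inl huv
  · exact Or.inr ((R.adj_iff_le huv).2 ⟨h, h'⟩)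

theorem not_adj_of_lt (R : IntervalRep G) {u v : V} (h : R.hi u < R.lo v) : ¬ G.Adj u v :=
  fun h' => absurd (R.le_of_adj h'.symm) (not_le.2 h)

theorem ne_of_lt (R : IntervalRep G) {u v : V} (h : R.hi u < R.lo v) : u ≠ v := by
  rintro rfl
  exact absurd (R.lo_lt_hi u) (not_lt.2 h.le)

/-- Non-adjacent distinct vertices have disjoint intervals. -/
theorem lt_or_lt (R : IntervalRep G) {u v : V} (h : u ≠ v) (h' : ¬ G.Adj u v) :
    R.hi u < R.lo v ∨ R.hi v < R.lo u := by
  rw [R.adj_iff_le h, not_and_or, not_le, not_le] at h'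
  exact h'.symm

/-- The vertices whose intervals contain the point `z`. -/
def bagAt (R : IntervalRep G) (z : ℝ) : Set V := {v | R.lo v ≤ z ∧ z ≤ R.hi v}

/-- An edge avoiding the bag of `z` does not cross `z`. -/
theorem hi_lt_of_adj (R : IntervalRep G) {u v : V} {z : ℝ} (h : G.Adj u v) (hu : R.hi u < z)
    (hv : v ∉ R.bagAt z) : R.hi v < z := by
  by_contra hz
  exact hv ⟨(R.le_of_adj h.symm).trans hu.le, not_lt.1 hz⟩

theorem lt_lo_of_adj (R : IntervalRep G) {u v : V} {z : ℝ} (h : G.Adj u v) (hu : z < R.lo u)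
    (hv : v ∉ R.bagAt z) : z < R.lo v := by
  by_contra hz
  exact hv ⟨not_lt.1 hz, hu.le.trans (R.le_of_adj h)⟩

/-- Intervals that cover a connected set and all meet it form a connected graph. -/
theorem connected_induce [Finite V] (R : IntervalRep G) {B : Set V} {J : Set ℝ} (hB : B.Nonempty)
    (hJ : IsPreconnected J) (hcov : J ⊆ ⋃ v ∈ B, Icc (R.lo v) (R.hi v))
    (hmeet : ∀ v ∈ B, (J ∩ Icc (R.lo v) (R.hi v)).Nonempty) : (G.induce B).Connected := by
  have : Nonempty B := hB.to_subtype
  refine SimpleGraph.Connected.mk fun x y => ?_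
  by_contra hxy
  -- The intervals of the component of `x` and the remaining ones form two closed sets that cover
  -- `J` and both meet it, so they share a point of `J`, which gives an edge leaving the component.
  set B₁ : Set V := {v | ∃ h : v ∈ B, (G.induce B).Reachable x ⟨v, h⟩} with hB₁
  have hclosed : ∀ C : Set V, IsClosed (⋃ v ∈ C, Icc (R.lo v) (R.hi v)) := fun C =>
    (Set.toFinite C).isClosed_biUnion fun v _ => isClosed_Icc
  obtain ⟨z, hzJ, hz₁, hz₂⟩ := isPreconnected_closed_iff.1 hJ _ _ (hclosed B₁) (hclosed (B \ B₁))
    (by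
      intro z hz
      obtain ⟨v, hv, hvz⟩ := mem_iUnion₂.1 (hcov hz)
      by_cases h : v ∈ B₁
      · exact Or.inl (mem_iUnion₂.2 ⟨v, h, hvz⟩)
      · exact Or.inr (mem_iUnion₂.2 ⟨v, ⟨hv, h⟩, hvz⟩))
    (by
      obtain ⟨z, hz, hz'⟩ := hmeet x x.2
      exact ⟨z, hz, mem_iUnion₂.2 ⟨x, ⟨x.2, SimpleGraph.Reachable.refl _⟩, hz'⟩⟩)
    (by
      obtain ⟨z, hz, hz'⟩ := hmeet y y.2
      exact ⟨z, hz, mem_iUnion₂.2 ⟨y, ⟨y.2, fun h => hxy h.2⟩, hz'⟩⟩)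
  obtain ⟨u, ⟨huB, hu⟩, huz⟩ := mem_iUnion₂.1 hz₁
  obtain ⟨v, ⟨hvB, hv⟩, hvz⟩ := mem_iUnion₂.1 hz₂
  rcases R.eq_or_adj (huz.1.trans hvz.2) (hvz.1.trans huz.2) with rfl | h
  · exact hv ⟨huB, hu⟩
  · exact hv ⟨hvB, hu.trans (SimpleGraph.Adj.reachable (by simpa using h))⟩

/-- If all bags strictly between `p` and `q` have at least `M` elements, the vertices whose
intervals meet `[p, q]` stay connected after the deletion of fewer than `M` of them. -/
theorem connected_induce_compl [Finite V] (R : IntervalRep G) {p q : ℝ} {M : ℕ} (hpq : p < q)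
    (hbag : ∀ z ∈ Ioo p q, M ≤ (R.bagAt z).ncard)
    {A : Set V} (hA : A = {v | p ≤ R.hi v ∧ R.lo v ≤ q}) (X : Finset A) (hX : X.card < M) :
    ((G.induce A).induce ((X : Set _)ᶜ)).Connected := by
  classical
  replace hA : ∀ v, v ∈ A ↔ p ≤ R.hi v ∧ R.lo v ≤ q := by simp [hA]
  set Y : Finset V := X.map (Function.Embedding.subtype _) with hY
  have hYX : ∀ v (h : v ∈ A), v ∈ Y ↔ (⟨v, h⟩ : A) ∈ X := by
    intro v h
    simp [hY, h]
  have hYc : Y.card < M := by simpa [hY] using hX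
  have hex : ∀ z ∈ Ioo p q, ∃ v ∈ A \ (Y : Set V), z ∈ Icc (R.lo v) (R.hi v) := by
    intro z hz
    by_contra! hcon
    refine absurd (hbag z hz) (not_le.2 (lt_of_le_of_lt ?_ hYc))
    rw [← Set.ncard_coe_finset]
    refine Set.ncard_le_ncard (fun v hv => ?_) (Set.toFinite _)
    by_contra hvY
    exact hcon v ⟨(hA v).2 ⟨hz.1.le.trans hv.2, hv.1.trans hz.2.le⟩, hvY⟩ hv
  have hconn : (G.induce (A \ (Y : Set V))).Connected := by
    have hclosed : IsClosed (⋃ v ∈ A \ (Y : Set V), Icc (R.lo v) (R.hi v)) :=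
      (Set.toFinite _).isClosed_biUnion fun v _ => isClosed_Icc
    refine R.connected_induce (J := Icc p q) ?_ isPreconnected_Icc ?_ ?_
    · obtain ⟨z, hz⟩ := nonempty_Ioo.2 hpq
      obtain ⟨v, hv, -⟩ := hex z hz
      exact ⟨v, hv⟩
    -- The union of the surviving intervals is closed, so nothing need be known about the bags of
    -- `p` and `q` themselves.
    · rw [← closure_Ioo hpq.ne]
      refine closure_minimal (fun z hz => ?_) hclosed
      obtain ⟨v, hv, hv'⟩ := hex z hz
      exact mem_iUnion₂.2 ⟨v, hv, hv'⟩
    · rintro v ⟨hv, -⟩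
      obtain ⟨h1, h2⟩ := (hA v).1 hv
      exact ⟨max p (R.lo v), ⟨le_max_left _ _, max_le hpq.le h2⟩, le_max_right _ _,
        max_le h1 (R.lo_lt_hi v).le⟩
  have hne : Nonempty ↥((X : Set A)ᶜ) := by
    obtain ⟨⟨v, hv, hvY⟩⟩ := hconn.nonempty
    exact ⟨⟨v, hv⟩, fun h => hvY ((hYX v hv).2 h)⟩
  refine SimpleGraph.Connected.mk fun x y => ?_
  let f : G.induce (A \ (Y : Set V)) →g (G.induce A).induce ((X : Set A)ᶜ) :=
    { toFun := fun v => ⟨⟨v, v.2.1⟩, fun h => v.2.2 ((hYX v v.2.1).2 h)⟩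
      map_rel' := fun h => h }
  have := (hconn.preconnected ⟨x.1.1, x.1.2, fun h => x.2 ((hYX _ x.1.2).1 h)⟩
    ⟨y.1.1, y.1.2, fun h => y.2 ((hYX _ y.1.2).1 h)⟩).map f
  exact this

/-- Connectivity comes from `connected_induce_compl`. That there are more than `M` vertices follows
from non-domination: all but one of the vertices of a nontrivial connected graph dominate it. -/
theorem isWide_of_bags [Finite V] (R : IntervalRep G) {p q : ℝ} {M : ℕ} (hpq : p < q)
    (hbag : ∀ z ∈ Ioo p q, M ≤ (R.bagAt z).ncard)
    (hdom : ∀ S : Finset V, S.card < M →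
      ¬ {v | p ≤ R.hi v ∧ R.lo v ≤ q} ⊆ closedNbhd G (S : Set V)) :
    IsWide G M {v | p ≤ R.hi v ∧ R.lo v ≤ q} := by
  classical
  refine ⟨⟨?_, R.connected_induce_compl hpq hbag rfl⟩, hdom⟩
  by_contra! hM
  obtain ⟨hM1, hM2⟩ := hM
  set A : Set V := {v | p ≤ R.hi v ∧ R.lo v ≤ q} with hA
  have hconn : (G.induce A).Connected := by
    have h := R.connected_induce_compl hpq hbag hA ∅ (by simp; omega)
    refine (SimpleGraph.Iso.connected_iff ?_).1 h
    exact { toEquiv := (Equiv.subtypeUnivEquiv (by simp)), map_rel_iff' := by simp }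
  have hAM : M ≤ A.ncard := by
    obtain ⟨z, hz⟩ := nonempty_Ioo.2 hpq
    exact (hbag z hz).trans (Set.ncard_le_ncard
      (fun v hv => ⟨hz.1.le.trans hv.2, hv.1.trans hz.2.le⟩) (Set.toFinite _))
  have : Nontrivial A := by
    have : 1 < Nat.card A := lt_of_lt_of_le hM1 hAM
    exact Finite.one_lt_card_iff_nontrivial.1 this
  obtain ⟨v⟩ := hconn.nonempty
  obtain ⟨u, hu⟩ := hconn.preconnected.exists_adj_of_nontrivial v
  have hfin : (A \ {v.1}).Finite := Set.toFinite _
  refine hdom hfin.toFinset ?_ ?_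
  · rw [← Set.ncard_eq_toFinset_card _ hfin]
    have := Set.ncard_sdiff_singleton_lt_of_mem v.2 (Set.toFinite A)
    exact this.trans_le hM2
  · intro x hx
    by_cases hxv : x = v
    · subst hxv
      refine Or.inr ⟨u, ?_, ?_⟩
      · have : u ≠ v := hu.ne'
        simp [Subtype.coe_inj, this]
      · exact hu.symm
    · left
      simp [hx, hxv]

/-- A nonempty set of vertices with a common point in their intervals is dominated by one
vertex. -/
theorem subset_closedNbhd_singleton (R : IntervalRep G) {T : Set V} {u : V} {q : ℝ}
    (hu : R.lo u ≤ q) (hT : ∀ v ∈ T, R.hi u ≤ R.hi v ∧ R.lo v ≤ q) (hq : q ≤ R.hi u) :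
    T ⊆ closedNbhd G (({u} : Finset V) : Set V) := by
  intro v hv
  rcases R.eq_or_adj (u := u) (v := v) (hu.trans (hq.trans (hT v hv).1))
    ((hT v hv).2.trans hq) with h | h
  · exact Or.inl (by simp [h])
  · exact Or.inr ⟨u, by simp, h⟩

/-- The extreme members of a nonempty set of vertices. -/
theorem exists_extreme [Finite V] (R : IntervalRep G) {T : Set V} (hT : T.Nonempty) :
    ∃ u ∈ T, ∃ v ∈ T, ∀ z ∈ T, R.hi u ≤ R.hi z ∧ R.lo z ≤ R.lo v := by
  obtain ⟨u, hu, hu'⟩ := Set.exists_min_image T R.hi (Set.toFinite T) hT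
  obtain ⟨v, hv, hv'⟩ := Set.exists_max_image T R.lo (Set.toFinite T) hT
  exact ⟨u, hu, v, hv, fun z hz => ⟨hu' z hz, hv' z hz⟩⟩

/-- A set that is not dominated by one vertex has extreme members with disjoint intervals. -/
theorem exists_extreme_lt [Finite V] (R : IntervalRep G) {T : Set V} {M : ℕ} (hM : 2 ≤ M)
    (hdom : ∀ S : Finset V, S.card < M → ¬ T ⊆ closedNbhd G (S : Set V)) :
    ∃ u ∈ T, ∃ v ∈ T, R.hi u < R.lo v ∧ ∀ z ∈ T, R.hi u ≤ R.hi z ∧ R.lo z ≤ R.lo v := by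
  have hT : T.Nonempty := by
    rw [Set.nonempty_iff_ne_empty]
    rintro rfl
    exact hdom ∅ (by simp; omega) (Set.empty_subset _)
  obtain ⟨u, hu, v, hv, h⟩ := R.exists_extreme hT
  refine ⟨u, hu, v, hv, ?_, h⟩
  by_contra! hlt
  refine hdom {u} (by simp; omega) (R.subset_closedNbhd_singleton (h u hu).2 h hlt)

/-- In an `M`-wide set, the bags between two members have at least `M` elements. -/
theorem le_ncard_bagAt_of_isWide [Finite V] (R : IntervalRep G) {A : Set V} {M : ℕ}
    (h : IsWide G M A) {u v : V} (hu : u ∈ A) (hv : v ∈ A) {z : ℝ} (huz : R.hi u < z)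
    (hzv : z < R.lo v) : M ≤ (R.bagAt z).ncard := by
  -- `A` stays connected after the deletion of such a small bag, but no walk avoiding the bag of `z`
  -- crosses `z`.
  by_contra! hM
  have := (h.linked hM hu hv (fun h => not_lt.2 h.2 huz) fun h => not_lt.2 h.1 hzv).induction
    (P := fun x => R.hi x < z) (fun _ _ hadj hd hc => R.hi_lt_of_adj hadj hc hd) huz
  exact absurd ((hzv.trans (R.lo_lt_hi v)).trans this) (lt_irrefl _)

/-- If no set is `(w + 1)`-wide and the bags between members of `T` have more than `w` elements,
then `T` is dominated by at most `w` vertices. -/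
theorem exists_dominating [Finite V] (R : IntervalRep G) {T : Set V} {w : ℕ} (hw : 1 ≤ w)
    (hwide : ∀ A, ¬ IsWide G (w + 1) A)
    (hbag : ∀ u ∈ T, ∀ v ∈ T, ∀ z, R.hi u < z → z < R.lo v → w < (R.bagAt z).ncard) :
    ∃ S : Finset V, S.card ≤ w ∧ T ⊆ closedNbhd G (S : Set V) := by
  by_contra! hcon
  have hdom : ∀ S : Finset V, S.card < w + 1 → ¬ T ⊆ closedNbhd G (S : Set V) :=
    fun S hS => hcon S (Nat.lt_succ_iff.1 hS)
  obtain ⟨u, hu, v, hv, huv, hext⟩ := R.exists_extreme_lt (M := w + 1) (by omega) hdom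
  exact hwide _ (R.isWide_of_bags huv (fun z hz => hbag u hu v hv z hz.1 hz.2)
    fun S hS hsub => hdom S hS (Set.Subset.trans hext hsub))

/-! ### Independence of the width from the representation -/

section Gaps

variable [Fintype V]

theorem exists_endpoint_eq (R : IntervalRep G) {x : ℝ} (hx : x ∈ R.endpoints) :
    ∃ i, R.endpoint i = x := by
  have : x ∈ Set.range (R.endpoints.orderEmbOfFin rfl) := by
    rw [Finset.range_orderEmbOfFin]; exact hx
  exact this

theorem lo_mem_endpoints (R : IntervalRep G) (v : V) : R.lo v ∈ R.endpoints := by simp [endpoints]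

theorem hi_mem_endpoints (R : IntervalRep G) (v : V) : R.hi v ∈ R.endpoints := by simp [endpoints]

theorem endpoint_lt_endpoint (R : IntervalRep G) {i j} : R.endpoint i < R.endpoint j ↔ i < j :=
  (R.endpoints.orderEmbOfFin rfl).lt_iff_lt

theorem endpoint_le_endpoint (R : IntervalRep G) {i j} : R.endpoint i ≤ R.endpoint j ↔ i ≤ j :=
  (R.endpoints.orderEmbOfFin rfl).le_iff_le

/-- A vertex is in the `i`-th bag if and only if its interval contains the `i`-th gap. -/
theorem mem_bag_iff (R : IntervalRep G) (i : Fin R.numGaps) (v : V) :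
    v ∈ R.bag i ↔ R.lo v ≤ R.endpoint ⟨i, Nat.lt_of_lt_pred i.isLt⟩ ∧
      R.endpoint ⟨i + 1, Nat.add_lt_of_lt_sub i.isLt⟩ ≤ R.hi v := by
  have hlt : R.endpoint ⟨i, Nat.lt_of_lt_pred i.isLt⟩ <
      R.endpoint ⟨i + 1, Nat.add_lt_of_lt_sub i.isLt⟩ :=
    R.endpoint_lt_endpoint.2 (by simp [Fin.lt_def])
  obtain ⟨s, hs⟩ := R.exists_endpoint_eq (R.lo_mem_endpoints v)
  obtain ⟨t, ht⟩ := R.exists_endpoint_eq (R.hi_mem_endpoints v)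
  simp only [bag, gapPoint, Set.mem_ofPred_eq, Set.mem_Icc]
  constructor
  · rintro ⟨h1, h2⟩
    have h1' : R.lo v < R.endpoint ⟨i + 1, Nat.add_lt_of_lt_sub i.isLt⟩ := by linarith
    have h2' : R.endpoint ⟨i, Nat.lt_of_lt_pred i.isLt⟩ < R.hi v := by linarith
    rw [← hs, endpoint_lt_endpoint, Fin.lt_def] at h1'
    rw [← ht, endpoint_lt_endpoint, Fin.lt_def] at h2'
    rw [← hs, ← ht, endpoint_le_endpoint, endpoint_le_endpoint, Fin.le_def, Fin.le_def]
    simp only at h1' h2' ⊢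
    omega
  · rintro ⟨h1, h2⟩
    constructor <;> linarith

theorem exists_gap (R : IntervalRep G) (v : V) : ∃ i : Fin R.numGaps, v ∈ R.bag i := by
  obtain ⟨s, hs⟩ := R.exists_endpoint_eq (R.lo_mem_endpoints v)
  obtain ⟨t, ht⟩ := R.exists_endpoint_eq (R.hi_mem_endpoints v)
  have hst : s < t := by
    rw [← R.endpoint_lt_endpoint, hs, ht]; exact R.lo_lt_hi v
  have ht' := t.2
  refine ⟨⟨s, by simp only [numGaps]; omega⟩, ?_⟩
  rw [mem_bag_iff, ← hs, ← ht, endpoint_le_endpoint, endpoint_le_endpoint, Fin.le_def, Fin.le_def]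
  simp only
  omega

/-- The intervals of one bag share a point, and the empty set dominates nothing. This supplies `1 ≤
R.w`. -/
theorem exists_isWide_one (R : IntervalRep G) [Nonempty V] :
    ∃ a b : Fin R.numGaps, a ≤ b ∧ IsWide G 1 (R.interval a b) := by
  obtain ⟨v⟩ := ‹Nonempty V›
  obtain ⟨a, ha⟩ := R.exists_gap v
  have hint : R.interval a a = R.bag a := by simp [interval]
  have hconn : (G.induce (R.bag a)).Connected := by
    refine R.connected_induce (J := {R.gapPoint a}) ⟨v, ha⟩ isPreconnected_singleton ?_ ?_
    · rintro z rfl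
      exact mem_iUnion₂.2 ⟨v, ha, ha⟩
    · intro u hu
      exact ⟨_, rfl, hu⟩
  refine ⟨a, a, le_rfl, ⟨Or.inl le_rfl, fun X hX => ?_⟩, fun S hS h => ?_⟩
  · obtain rfl : X = ∅ := by simpa using hX
    rw [hint]
    refine (SimpleGraph.Iso.connected_iff ?_).2 hconn
    exact { toEquiv := (Equiv.subtypeUnivEquiv (by simp)), map_rel_iff' := by simp }
  · obtain rfl : S = ∅ := by simpa using hS
    rw [hint] at h
    simpa [closedNbhd] using h ha

/-- If some set of vertices is `M`-wide then so is some interval subgraph. -/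
theorem exists_isWide_interval (R : IntervalRep G) [Nonempty V] {A : Set V} {M : ℕ}
    (h : IsWide G M A) : ∃ a b : Fin R.numGaps, a ≤ b ∧ IsWide G M (R.interval a b) := by
  rcases Nat.lt_or_ge M 2 with hM | hM
  · obtain ⟨a, b, hab, hw⟩ := R.exists_isWide_one
    exact ⟨a, b, hab, hw.mono (by omega)⟩
  obtain ⟨u, hu, v, hv, huv, hext⟩ := R.exists_extreme_lt hM h.2
  have hwide := R.isWide_of_bags (M := M) huv
    (fun z hz => R.le_ncard_bagAt_of_isWide h hu hv hz.1 hz.2)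
    (fun S hS hsub => h.2 S hS (Set.Subset.trans hext hsub))
  obtain ⟨s, hs⟩ := R.exists_endpoint_eq (R.lo_mem_endpoints u)
  obtain ⟨p, hp⟩ := R.exists_endpoint_eq (R.hi_mem_endpoints u)
  obtain ⟨q, hq⟩ := R.exists_endpoint_eq (R.lo_mem_endpoints v)
  obtain ⟨t, ht⟩ := R.exists_endpoint_eq (R.hi_mem_endpoints v)
  have hsp : s < p := by rw [← R.endpoint_lt_endpoint, hs, hp]; exact R.lo_lt_hi u
  have hpq : p < q := by rw [← R.endpoint_lt_endpoint, hq, hp]; exact huv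
  have hqt : q < t := by rw [← R.endpoint_lt_endpoint, hq, ht]; exact R.lo_lt_hi v
  have ht' := t.2
  rw [Fin.lt_def] at hsp hpq hqt
  -- Gap `p - 1` ends at `hi u` and gap `q` begins at `lo v`: an interval that only touches `[hi u,
  -- lo v]` from outside still contains one of these two gaps.
  refine ⟨⟨p - 1, by simp only [numGaps]; omega⟩, ⟨q, by simp only [numGaps]; omega⟩,
    by simp only [Fin.le_def]; omega, ?_⟩
  convert hwide using 1
  ext x
  obtain ⟨c, hc⟩ := R.exists_endpoint_eq (R.lo_mem_endpoints x)
  obtain ⟨d, hd⟩ := R.exists_endpoint_eq (R.hi_mem_endpoints x)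
  have hcd : c < d := by rw [← R.endpoint_lt_endpoint, hc, hd]; exact R.lo_lt_hi x
  have hd' := d.2
  rw [Fin.lt_def] at hcd
  simp only [interval, mem_iUnion, mem_bag_iff, ← hc, ← hd, ← hp, ← hq, endpoint_le_endpoint,
    Set.mem_Icc, Fin.le_def, Set.mem_ofPred_eq, exists_prop]
  constructor
  · rintro ⟨i, h1, h2⟩
    omega
  · intro h
    refine ⟨⟨max c (p - 1), by simp only [numGaps]; omega⟩, ?_⟩
    simp only
    omega

/-- `w(G)` is the largest `M` such that some set of vertices is `M`-wide. -/
theorem le_w_iff (R : IntervalRep G) [Nonempty V] {M : ℕ} :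
    M ≤ R.w ↔ ∃ A, IsWide G M A := by
  constructor
  · intro h
    obtain ⟨a, b, -, hw⟩ := R.isGreatest_w.1
    exact ⟨_, hw.mono h⟩
  · rintro ⟨A, hA⟩
    exact R.isGreatest_w.2 (R.exists_isWide_interval hA)

end Gaps

end IntervalRep

/-- Every interval graph has a representation by intervals of positive length. -/
theorem IsIntervalGraph.nonempty_intervalRep {V : Type*} [Finite V] {G : SimpleGraph V}
    (h : IsIntervalGraph G) : Nonempty (IntervalRep G) := by
  obtain ⟨lo, hi, hle, hadj⟩ := h
  -- Finitely many strict inequalities survive a small `ε`, so lengthening all intervals on the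
  -- right creates no new intersection.
  have hε : ∀ᶠ ε in nhdsWithin (0 : ℝ) (Ioi 0), ∀ u v, hi u < lo v → hi u + ε < lo v := by
    rw [Filter.eventually_all]
    intro u
    rw [Filter.eventually_all]
    intro v
    rw [Filter.eventually_imp_distrib_left]
    intro huv
    have : Set.Iio (lo v - hi u) ∈ nhds (0 : ℝ) := Iio_mem_nhds (by linarith)
    filter_upwards [mem_nhdsWithin_of_mem_nhds this] with ε hε
    rw [Set.mem_Iio] at hε
    linarith
  obtain ⟨ε, hε, hpos⟩ := (hε.and self_mem_nhdsWithin).exists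
  refine ⟨⟨lo, fun v => hi v + ε, fun v => by linarith [hle v], fun u v huv => ?_⟩⟩
  rw [hadj u v huv]
  constructor
  · rintro ⟨x, ⟨h1, h2⟩, h3, h4⟩
    exact ⟨x, ⟨h1, by linarith⟩, h3, by linarith⟩
  · rintro ⟨x, ⟨h1, h2⟩, h3, h4⟩
    have h5 : lo v ≤ hi u := by
      by_contra! hlt
      linarith [hε u v hlt]
    have h6 : lo u ≤ hi v := by
      by_contra! hlt
      linarith [hε v u hlt]
    exact ⟨max (lo u) (lo v), ⟨le_max_left _ _, max_le (hle u) h5⟩, le_max_right _ _,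
      max_le h6 (hle v)⟩


/-! ### Strategies for the robber and for the cops -/

section Game

variable {V : Type*} {G : SimpleGraph V} {k : ℕ}

theorem RobberMove.trans {S : Set V} {a b c : V} (h : RobberMove G S a b)
    (h' : RobberMove G S b c) : RobberMove G S a c := by
  obtain ⟨p, hp⟩ := h
  obtain ⟨q, hq⟩ := h'
  refine ⟨p.append q, fun v hv => ?_⟩
  rcases (SimpleGraph.Walk.mem_support_append_iff p q).1 hv with h | h
  exacts [hp v h, hq v h]

theorem RobberMove.refl {S : Set V} {a : V} (h : a ∉ S) : RobberMove G S a a :=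
  ⟨.nil, by simpa using h⟩

theorem RobberMove.anti {S S' : Set V} {a b : V} (h : RobberMove G S' a b) (hS : S ⊆ S') :
    RobberMove G S a b := by
  obtain ⟨p, hp⟩ := h
  exact ⟨p, fun v hv hv' => hp v hv (hS hv')⟩

theorem RobberMove.notMem_left {S : Set V} {a b : V} (h : RobberMove G S a b) : a ∉ S := by
  obtain ⟨p, hp⟩ := h
  exact hp _ p.start_mem_support

/-- A property preserved along the edges outside `S` is preserved by robber moves. -/
theorem RobberMove.induction {S : Set V} {P : V → Prop}
    (hP : ∀ u v, G.Adj u v → v ∉ S → P u → P v) {a b : V} (h : RobberMove G S a b) (ha : P a) :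
    P b := by
  obtain ⟨p, hp⟩ := h
  induction p with
  | nil => exact ha
  | cons hadj p ih =>
    exact ih (hP _ _ hadj (hp _ (by simp)) ha) (fun v hv => hp v (by simp [hv]))

/-- Before each turn of the cops the robber is in `A` and outside their closed neighbourhood; she
can restore this after any cop move, so no winning tree contains such a position. -/
theorem not_winFrom_of_isWide {A : Set V} (h : ∀ X : Finset A, X.card ≤ k →
      ((G.induce A).induce ((X : Set A)ᶜ)).Connected)
    (hdom : ∀ S : Finset V, S.card ≤ k → ¬ A ⊆ closedNbhd G (S : Set V))
    {C : Fin k → V} {r : V} (hw : WinFrom G C r) (hr : r ∈ A)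
    (hrC : r ∉ closedNbhd G (Set.range C)) : False := by
  classical
  induction hw with
  | captured C r i h => exact hrC (Or.inl ⟨i, h⟩)
  | move C r C' hC _ ih =>
    have hcard : (Finset.univ.image C').card ≤ k :=
      Finset.card_image_le.trans (by simp)
    obtain ⟨r', hr', hr'C⟩ := Set.not_subset.1 (hdom _ hcard)
    simp only [Finset.coe_image, Finset.coe_univ, Set.image_univ] at hr'C
    refine ih r' ?_ hr' hr'C
    have hrC' : r ∉ Set.range C' := by
      rintro ⟨i, hi⟩
      rcases hC i with h | h
      · exact hrC (Or.inl ⟨i, h ▸ hi⟩)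
      · exact hrC (Or.inr ⟨C i, ⟨i, rfl⟩, hi ▸ h⟩)
    have hX : ((Finset.univ.image C').subtype (· ∈ A)).card ≤ k := by
      rw [Finset.card_subtype]
      exact (Finset.card_filter_le _ _).trans hcard
    have hmem : ∀ x : A, x ∈ ((((Finset.univ.image C').subtype (· ∈ A) : Finset A) : Set A)ᶜ) ↔
        x.1 ∉ Set.range C' := by
      intro x; simp
    obtain ⟨p⟩ := (h _ hX).preconnected ⟨⟨r, hr⟩, (hmem _).2 hrC'⟩
      ⟨⟨r', hr'⟩, (hmem _).2 fun h => hr'C (Or.inl h)⟩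
    let f : (G.induce A).induce
        ((((Finset.univ.image C').subtype (· ∈ A) : Finset A) : Set A)ᶜ) →g G :=
      { toFun := fun v => v.1.1, map_rel' := fun h => h }
    refine ⟨p.map f, fun v hv => ?_⟩
    rw [SimpleGraph.Walk.support_map, List.mem_map] at hv
    obtain ⟨x, -, rfl⟩ := hv
    exact (hmem _).1 x.2

/-- Fewer than `M` cops do not win if there is an `M`-wide set. -/
theorem le_of_isWide_of_copsWin {A : Set V} {M : ℕ} (h : IsWide G M A) (hk : CopsWin G k) :
    M ≤ k := by
  classical
  by_contra! hM
  obtain ⟨C, hC⟩ := hk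
  have hcard : (Finset.univ.image C).card < M :=
    (Finset.card_image_le.trans (by simp)).trans_lt hM
  obtain ⟨r, hr, hrC⟩ := Set.not_subset.1 (h.2 _ hcard)
  simp only [Finset.coe_image, Finset.coe_univ, Set.image_univ] at hrC
  exact not_winFrom_of_isWide (fun X hX => h.1.2 X (hX.trans_lt hM))
    (fun S hS => h.2 S (hS.trans_lt hM)) (hC r) hr hrC

theorem exists_adj_dist_lt (hG : G.Connected) {u v : V} (h : u ≠ v) :
    ∃ c, G.Adj u c ∧ G.dist c v < G.dist u v := by
  obtain ⟨p, hp⟩ := hG.exists_walk_length_eq_dist u v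
  cases p with
  | nil => exact absurd rfl h
  | cons hadj q =>
    refine ⟨_, hadj, (SimpleGraph.dist_le q).trans_lt ?_⟩
    rw [← hp, SimpleGraph.Walk.length_cons]
    exact Nat.lt_succ_self _

/-- The cops can move to any positions `D` while those already in place guard. -/
theorem winFrom_of_target (hG : G.Connected) (D : Fin k → V) {C : Fin k → V} {r : V} {S : Set V}
    (hS : ∀ v ∈ S, ∃ i, C i = v ∧ D i = v)
    (hD : ∀ r', RobberMove G S r r' → WinFrom G D r') : WinFrom G C r := by
  -- Every cop not yet in place steps closer, so the total distance drops. The cops on `S` never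
  -- move, hence the robber's successive moves compose to one that avoids `S`.
  induction hm : ∑ i, G.dist (C i) (D i) using Nat.strong_induction_on generalizing C r with
  | _ m ih =>
  by_cases hr : r ∈ S
  · obtain ⟨i, hi, -⟩ := hS r hr
    exact .captured C r i hi
  by_cases hCD : C = D
  · subst hCD
    exact hD r (.refl hr)
  have hstep : ∀ i, ∃ c, (c = C i ∨ G.Adj (C i) c) ∧ G.dist c (D i) ≤ G.dist (C i) (D i) ∧
      (C i = D i → c = C i) ∧ (C i ≠ D i → G.dist c (D i) < G.dist (C i) (D i)) := by
    intro i
    by_cases h : C i = D i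
    · exact ⟨C i, Or.inl rfl, le_rfl, fun _ => rfl, fun h' => absurd h h'⟩
    · obtain ⟨c, hc, hlt⟩ := exists_adj_dist_lt hG h
      exact ⟨c, Or.inr hc, hlt.le, fun h' => absurd h' h, fun _ => hlt⟩
  choose C' h1 h2 h3 h4 using hstep
  obtain ⟨j, hj⟩ := Function.ne_iff.1 hCD
  have hlt : ∑ i, G.dist (C' i) (D i) < m := by
    rw [← hm]
    exact Finset.sum_lt_sum (fun i _ => h2 i) ⟨j, Finset.mem_univ _, h4 j hj⟩
  have hS' : ∀ v ∈ S, ∃ i, C' i = v ∧ D i = v := by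
    intro v hv
    obtain ⟨i, hi, hi'⟩ := hS v hv
    exact ⟨i, (h3 i (hi.trans hi'.symm)).trans hi, hi'⟩
  refine .move C r C' h1 fun r' hr' => ih _ hlt hS' (fun r'' hr'' => hD r'' ?_) rfl
  refine RobberMove.trans (hr'.anti ?_) hr''
  intro v hv
  obtain ⟨i, hi, -⟩ := hS' v hv
  exact ⟨i, hi⟩

/-- A cop in the closed neighbourhood of the robber captures her. -/
theorem winFrom_of_mem_closedNbhd {C : Fin k → V} {r : V}
    (h : r ∈ closedNbhd G (Set.range C)) : WinFrom G C r := by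
  classical
  rcases h with ⟨i, hi⟩ | ⟨_, ⟨i, rfl⟩, hi⟩
  · exact .captured C r i hi
  · refine .move C r (Function.update C i r) (fun j => ?_) fun r' hr' => ?_
    · by_cases hj : j = i
      · subst hj; right; simpa using hi
      · left; simp [hj]
    · exact absurd ⟨i, by simp⟩ hr'.notMem_left

theorem closedNbhd_mono {S T : Set V} (h : S ⊆ T) : closedNbhd G S ⊆ closedNbhd G T :=
  fun _ hv => hv.imp (fun h' => h h') fun ⟨s, hs, hsv⟩ => ⟨s, h hs, hsv⟩

/-- Reassigning the cops of one group to cover a set with at most `w` elements. -/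
theorem exists_reassign [Nonempty V] {w : ℕ} (C : Fin (3 * w) → V) (g : Fin 3) (S : Finset V)
    (hS : S.card ≤ w) : ∃ D : Fin (3 * w) → V,
      (∀ i, (finProdFinEquiv.symm i).1 ≠ g → D i = C i) ∧
      ∀ v ∈ S, ∃ i, (finProdFinEquiv.symm i).1 = g ∧ D i = v := by
  classical
  obtain ⟨v₀⟩ := ‹Nonempty V›
  let f : Fin w → V := fun j => if h : j.1 < S.card then (S.equivFin.symm ⟨j, h⟩ : V) else v₀
  refine ⟨fun i => if (finProdFinEquiv.symm i).1 = g then f (finProdFinEquiv.symm i).2 else C i,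
    fun i hi => if_neg hi, fun v hv => ?_⟩
  let j : Fin w := ⟨S.equivFin ⟨v, hv⟩, (Fin.is_lt _).trans_le hS⟩
  refine ⟨finProdFinEquiv (g, j), by simp, ?_⟩
  have : (j : ℕ) < S.card := (S.equivFin ⟨v, hv⟩).2
  simp only [Equiv.symm_apply_apply, if_true, f, dif_pos this, j]
  simp

namespace IntervalRep

/-- The robber cannot pass a guarded point from right to left. -/
theorem lt_lo_of_robberMove (R : IntervalRep G) {r r' : V} {y : ℝ}
    (h : RobberMove G (R.bagAt y) r r') (hr : y < R.lo r) : y < R.lo r' :=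
  h.induction (P := fun v => y < R.lo v) (fun _ _ hadj hv hu => R.lt_lo_of_adj hadj hu hv) hr

theorem hi_lt_of_robberMove (R : IntervalRep G) {r r' : V} {z : ℝ}
    (h : RobberMove G (R.bagAt z) r r') (hr : R.hi r < z) : R.hi r' < z :=
  h.induction (P := fun v => R.hi v < z) (fun _ _ hadj hv hu => R.hi_lt_of_adj hadj hu hv) hr

/-- The three groups of cops sweep from left to right: one group guards the bag of `y`, and
the robber is to the right of `y`. -/
theorem winFrom_of_guard [Finite V] (R : IntervalRep G) (hG : G.Connected) {w : ℕ} (hw : 1 ≤ w)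
    (hwide : ∀ A, ¬ IsWide G (w + 1) A) (y : ℝ) (C : Fin (3 * w) → V) (g : Fin 3)
    (hC : ∀ v ∈ R.bagAt y, ∃ i, (finProdFinEquiv.symm i).1 = g ∧ C i = v) (r : V)
    (hr : y < R.lo r) : WinFrom G C r := by
  classical
  have := hG.nonempty
  induction hm : {v | y < R.lo v}.ncard using Nat.strong_induction_on generalizing y C g r with
  | _ m ih =>
  have hg1 : g + 1 ≠ g := by clear * -; revert g; decide
  have hg2 : g + 2 ≠ g := by clear * -; revert g; decide
  have hg3 : g + 2 ≠ g + 1 := by clear * -; revert g; decide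
  -- Candidates for the next guarded point. Demanding an interval strictly between `y` and `z` makes
  -- the induction progress.
  by_cases hZ : ∃ z, y < z ∧ (R.bagAt z).ncard ≤ w ∧ {v | y < R.lo v ∧ R.hi v < z}.Nonempty
  · obtain ⟨z, ⟨hyz, hzw, t, ht⟩, hmin⟩ : ∃ z, (y < z ∧ (R.bagAt z).ncard ≤ w ∧
        {v | y < R.lo v ∧ R.hi v < z}.Nonempty) ∧ ∀ z', (y < z' ∧ (R.bagAt z').ncard ≤ w ∧
        {v | y < R.lo v ∧ R.hi v < z'}.Nonempty) →
        {v | y < R.lo v ∧ R.hi v < z}.ncard ≤ {v | y < R.lo v ∧ R.hi v < z'}.ncard := by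
      obtain ⟨z₀, hz₀⟩ := hZ
      obtain ⟨z, hz, hmin⟩ := (measure fun z : ℝ => {v | y < R.lo v ∧ R.hi v < z}.ncard).wf.has_min
        {z | y < z ∧ (R.bagAt z).ncard ≤ w ∧ {v | y < R.lo v ∧ R.hi v < z}.Nonempty} ⟨z₀, hz₀⟩
      exact ⟨z, hz, fun z' hz' => not_lt.1 (hmin z' hz')⟩
    -- A bag of size at most `w` between two members `u`, `v` of the pocket would give a candidate
    -- whose pocket keeps `u` and loses `v`, against minimality.
    obtain ⟨S, hSw, hS⟩ := R.exists_dominating (T := {v | y < R.lo v ∧ R.hi v < z}) hw hwide (by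
      intro u hu v hv z' huz hzv
      by_contra! hz'
      refine absurd (hmin z' ⟨hu.1.trans ((R.lo_lt_hi u).trans huz), hz', u, hu.1, huz⟩)
        (not_le.2 (Set.ncard_lt_ncard ⟨fun x hx => ⟨hx.1, ?_⟩, fun hsub => ?_⟩ (Set.toFinite _)))
      · exact hx.2.trans (hzv.trans ((R.lo_lt_hi v).trans hv.2))
      · exact absurd (hsub hv).2 (not_lt.2 (hzv.trans (R.lo_lt_hi v)).le))
    have hfin : (R.bagAt z).Finite := Set.toFinite _
    obtain ⟨D, hD, hDz⟩ := exists_reassign C (g + 1) hfin.toFinset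
      (by rwa [← Set.ncard_eq_toFinset_card _ hfin])
    simp only [Set.Finite.mem_toFinset] at hDz
    refine winFrom_of_target hG D (S := R.bagAt y) ?_ fun r' hr' => ?_
    · intro v hv
      obtain ⟨i, hi, hiv⟩ := hC v hv
      exact ⟨i, hiv, (hD i (by rw [hi]; exact hg1.symm)).trans hiv⟩
    have hyr' := R.lt_lo_of_robberMove hr' hr
    -- To the right of `z` the induction applies; in the pocket she is shut in by two groups while
    -- the third moves to `S`; otherwise her interval contains `z` and a cop is on her.
    rcases lt_or_ge z (R.lo r') with hzr | hzr
    · refine ih _ ?_ z D (g + 1) hDz r' hzr rfl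
      rw [← hm]
      refine Set.ncard_lt_ncard ⟨fun x hx => hyz.trans hx, fun hsub => ?_⟩ (Set.toFinite _)
      exact absurd (hsub ht.1) (not_lt.2 ((R.lo_lt_hi t).trans ht.2).le)
    rcases lt_or_ge (R.hi r') z with hrz | hrz
    · obtain ⟨E, hE, hES⟩ := exists_reassign D (g + 2) S hSw
      refine winFrom_of_target hG E (S := R.bagAt y ∪ R.bagAt z) ?_ fun r'' hr'' => ?_
      · rintro v (hv | hv)
        · obtain ⟨i, hi, hiv⟩ := hC v hv
          have := (hD i (by rw [hi]; exact hg1.symm)).trans hiv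
          exact ⟨i, this, (hE i (by rw [hi]; exact hg2.symm)).trans this⟩
        · obtain ⟨i, hi, hiv⟩ := hDz v hv
          exact ⟨i, hiv, (hE i (by rw [hi]; exact hg3.symm)).trans hiv⟩
      · refine winFrom_of_mem_closedNbhd (closedNbhd_mono ?_ (hS ⟨R.lt_lo_of_robberMove
          (hr''.anti Set.subset_union_left) hyr', R.hi_lt_of_robberMove
          (hr''.anti Set.subset_union_right) hrz⟩))
        intro v hv
        obtain ⟨i, -, hi⟩ := hES v hv
        exact ⟨i, hi⟩
    · obtain ⟨i, -, hi⟩ := hDz r' ⟨hzr, hrz⟩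
      exact .captured _ _ i hi
  -- With no candidate left, the whole territory to the right of `y` is a pocket.
  · obtain ⟨S, hSw, hS⟩ := R.exists_dominating (T := {v | y < R.lo v}) hw hwide (by
      intro u hu v hv z huz hzv
      by_contra! hz
      exact hZ ⟨z, (lt_trans hu (R.lo_lt_hi u)).trans huz, hz, u, hu, huz⟩)
    obtain ⟨D, hD, hDS⟩ := exists_reassign C (g + 1) S hSw
    refine winFrom_of_target hG D (S := R.bagAt y) ?_ fun r' hr' => ?_
    · intro v hv
      obtain ⟨i, hi, hiv⟩ := hC v hv
      exact ⟨i, hiv, (hD i (by rw [hi]; exact hg1.symm)).trans hiv⟩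
    · refine winFrom_of_mem_closedNbhd (closedNbhd_mono ?_ (hS (R.lt_lo_of_robberMove hr' hr)))
      intro v hv
      obtain ⟨i, -, hi⟩ := hDS v hv
      exact ⟨i, hi⟩

/-- If no set is `(w + 1)`-wide then `3 w` cops win. -/
theorem copsWin_of_not_isWide [Finite V] (R : IntervalRep G) (hG : G.Connected) {w : ℕ}
    (hw : 1 ≤ w) (hwide : ∀ A, ¬ IsWide G (w + 1) A) : CopsWin G (3 * w) := by
  have := hG.nonempty
  obtain ⟨u, hu⟩ := Finite.exists_min R.lo
  -- To the left of all intervals the bag is empty, hence guarded by any positions.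
  refine ⟨fun _ => u, fun r => R.winFrom_of_guard hG hw hwide (R.lo u - 1) _ 0 (fun v hv => ?_) r
    (by linarith [hu r])⟩
  have := hv.1
  linarith [hu v]

end IntervalRep

/-- The width is a lower bound for the cop number. -/
theorem IntervalRep.w_le_copNumber {V : Type*} [Fintype V] {G : SimpleGraph V} [Nonempty V]
    (R : IntervalRep G) : R.w ≤ copNumber G := by
  obtain ⟨A, hA⟩ := R.le_w_iff.1 le_rfl
  exact le_of_isWide_of_copsWin hA (isLeast_copNumber G).1

/-- Three times the width is an upper bound for the cop number. -/
theorem IntervalRep.copNumber_le {V : Type*} [Fintype V] {G : SimpleGraph V}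
    (hG : G.Connected) (R : IntervalRep G) : copNumber G ≤ 3 * R.w := by
  have := hG.nonempty
  obtain ⟨a, b, -, h1⟩ := R.exists_isWide_one
  refine (isLeast_copNumber G).2 (R.copsWin_of_not_isWide hG (R.le_w_iff.2 ⟨_, h1⟩) ?_)
  intro A hA
  exact absurd (R.le_w_iff.2 ⟨A, hA⟩) (by omega)

end Game


/-! ### A language of polynomial-time computable terms -/

/-- Terms of a small functional language over a graph on `Fin n`: variables range over `Fin n`,
arrays are indexed by `Fin n`. `sum x e` is the sum of `e` over all values of the variable `x`,
and `iter k x f g` is the value of `g` when the array `k` has been filled with zeros and then updated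
`n` times by `f` (as a function of the variable `x`). -/
inductive Tm
  | const (c : ℕ)
  | var (x : ℕ)
  | adj (x y : ℕ)
  | arr (k x : ℕ)
  | add (e f : Tm)
  | sub (e f : Tm)
  | sum (x : ℕ) (e : Tm)
  | iter (k x : ℕ) (f g : Tm)

namespace Tm

open Classical in
/-- The value of a term under an assignment of the variables and arrays. -/
noncomputable def val {n : ℕ} (G : SimpleGraph (Fin n)) :
    Tm → (ℕ → Fin n) → (ℕ → Fin n → ℕ) → ℕ
  | const c, _, _ => c
  | var x, ρ, _ => ρ x
  | adj x y, ρ, _ => if G.Adj (ρ x) (ρ y) then 1 else 0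
  | arr k x, ρ, A => A k (ρ x)
  | add e f, ρ, A => val G e ρ A + val G f ρ A
  | sub e f, ρ, A => val G e ρ A - val G f ρ A
  | sum x e, ρ, A => ∑ i, val G e (Function.update ρ x i) A
  | iter k x f g, ρ, A =>
      val G g ρ (Function.update A k
        ((fun S i => val G f (Function.update ρ x i) (Function.update A k S))^[n] fun _ => 0))

/-- A term is well scoped in `D`, `a` if its free variables are in `D`, its free arrays are below `a`,
bound variables are new, and bound arrays are numbered by their depth. -/
def wellScoped : Tm → List ℕ → ℕ → Bool
  | const _, _, _ => true
  | var x, D, _ => decide (x ∈ D)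
  | adj x y, D, _ => decide (x ∈ D) && decide (y ∈ D)
  | arr k x, D, a => decide (k < a) && decide (x ∈ D)
  | add e f, D, a => wellScoped e D a && wellScoped f D a
  | sub e f, D, a => wellScoped e D a && wellScoped f D a
  | sum x e, D, a => decide (x ∉ D) && wellScoped e (x :: D) a
  | iter k x f g, D, a =>
      decide (k = a) && decide (x ∉ D) && wellScoped f (x :: D) (a + 1) && wellScoped g D (a + 1)

end Tm

/-! ### Compilation -/

namespace Compile

/-- The register of a variable. -/
def vr (x : ℕ) : ℕ := 2 * x + 2

/-- A register for intermediate results. -/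
def tp (t : ℕ) : ℕ := 2 * t + 3

/-- `k` times the number of vertices. -/
def mulN : ℕ → Expr
  | 0 => .const 0
  | k + 1 => .add (mulN k) (.reg 0)

/-- The address of the cell of the array block `k` indexed by a register. -/
def cell (k r : ℕ) : Expr := .add (.add (.reg 1) (mulN k)) (.reg r)

/-- Execute `P` with the register `r` running through `n - 1, …, 0`. -/
def forAll (r : ℕ) (P : Prog) : Prog :=
  .seq (.set r (.reg 0)) (.loop (.reg r) (.seq (.set r (.sub (.reg r) (.const 1))) P))

/-- Fill the array block `b` with the values of `e` after execution of `P`, where the index is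
in the register of the variable `x`. -/
def fill (x b : ℕ) (P : Prog) (e : Expr) : Prog :=
  forAll (vr x) (.seq P (.store (cell b (vr x)) e))

/-- Compilation of a term: the value is put into the register `tp t`. -/
def comp : Tm → ℕ → Prog
  | .const c, t => .set (tp t) (.const c)
  | .var x, t => .set (tp t) (.reg (vr x))
  | .adj x y, t =>
      .seq (.set (tp t) (.const 0))
        (.seq (.set (tp (t + 1)) (.reg (vr x)))
          (.seq (.loop (.reg (tp (t + 1)))
            (.seq (.set (tp (t + 1)) (.sub (.reg (tp (t + 1))) (.const 1)))
              (.set (tp t) (.add (.reg (tp t)) (.reg 0)))))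
            (.set (tp t) (.mem (.add (.reg (tp t)) (.reg (vr y)))))))
  | .arr k x, t => .set (tp t) (.mem (cell (2 * k) (vr x)))
  | .add e f, t =>
      .seq (comp e t) (.seq (comp f (t + 1)) (.set (tp t) (.add (.reg (tp t)) (.reg (tp (t + 1))))))
  | .sub e f, t =>
      .seq (comp e t) (.seq (comp f (t + 1)) (.set (tp t) (.sub (.reg (tp t)) (.reg (tp (t + 1))))))
  | .sum x e, t =>
      .seq (.set (tp t) (.const 0))
        (forAll (vr x)
          (.seq (comp e (t + 1)) (.set (tp t) (.add (.reg (tp t)) (.reg (tp (t + 1)))))))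
  | .iter k x f g, t =>
      .seq (fill x (2 * k) .skip (.const 0))
        (.seq
          (forAll (tp t)
            (.seq (fill x (2 * k + 1) (comp f (t + 1)) (.reg (tp (t + 1))))
              (fill x (2 * k) .skip (.mem (cell (2 * k + 1) (vr x))))))
          (comp g t))

/-- The registers and memory cells that must not change: the variables in `D`, `b` array blocks and
`t` intermediate results are in use. -/
structure Keeps (n : ℕ) (D : List ℕ) (b t : ℕ) (s s' : State) : Prop where
  fixed : ∀ r ≤ 1, s'.reg r = s.reg r
  var : ∀ x ∈ D, s'.reg (vr x) = s.reg (vr x)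
  tmp : ∀ u < t, s'.reg (tp u) = s.reg (tp u)
  mem : ∀ c < n * n + b * n, s'.mem c = s.mem c

/-- The state represents the graph and an assignment of the variables in `D` and `a` arrays. -/
structure Repr {n : ℕ} (G : SimpleGraph (Fin n)) (D : List ℕ) (a : ℕ) (ρ : ℕ → Fin n)
    (A : ℕ → Fin n → ℕ) (s : State) : Prop where
  size : s.reg 0 = n
  sq : s.reg 1 = n * n
  adj : ∀ i j : Fin n, s.mem (i * n + j) = (open Classical in if G.Adj i j then 1 else 0)
  var : ∀ x ∈ D, s.reg (vr x) = ρ x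
  arr : ∀ k < a, ∀ i : Fin n, s.mem (n * n + 2 * k * n + i) = A k i

theorem Keeps.refl (n : ℕ) (D : List ℕ) (b t : ℕ) (s : State) : Keeps n D b t s s :=
  ⟨fun _ _ => rfl, fun _ _ => rfl, fun _ _ => rfl, fun _ _ => rfl⟩

theorem Keeps.trans {n : ℕ} {D : List ℕ} {b t : ℕ} {s s' s'' : State} (h : Keeps n D b t s s')
    (h' : Keeps n D b t s' s'') : Keeps n D b t s s'' :=
  ⟨fun r hr => (h'.fixed r hr).trans (h.fixed r hr), fun r hr => (h'.var r hr).trans (h.var r hr),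
    fun r hr => (h'.tmp r hr).trans (h.tmp r hr), fun r hr => (h'.mem r hr).trans (h.mem r hr)⟩

theorem Keeps.mono {n : ℕ} {D D' : List ℕ} {b b' t t' : ℕ} {s s' : State}
    (h : Keeps n D' b' t' s s') (hD : D ⊆ D') (hb : b ≤ b') (ht : t ≤ t') : Keeps n D b t s s' :=
  ⟨h.fixed, fun x hx => h.var x (hD hx), fun u hu => h.tmp u (hu.trans_le ht),
    fun c hc => h.mem c (hc.trans_le (by gcongr))⟩

/-- Registers `0` and `1` hold `n` and `n * n`; variables have the even registers from `2` on and
intermediate results the odd ones from `3` on, so parity keeps them apart. -/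
theorem Keeps.update_var {n : ℕ} {D : List ℕ} {b t : ℕ} (s : State) {x : ℕ} (hx : x ∉ D) (v : ℕ) :
    Keeps n D b t s { s with reg := Function.update s.reg (vr x) v } := by
  refine ⟨fun r hr => ?_, fun y hy => ?_, fun u hu => ?_, fun _ _ => rfl⟩
  · exact Function.update_of_ne (by simp only [vr]; omega) _ _
  · refine Function.update_of_ne ?_ _ _
    have : y ≠ x := fun h => hx (h ▸ hy)
    simp only [vr]; omega
  · exact Function.update_of_ne (by simp only [vr, tp]; omega) _ _

theorem Keeps.update_tmp {n : ℕ} {D : List ℕ} {b t : ℕ} (s : State) {u : ℕ} (hu : t ≤ u) (v : ℕ) :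
    Keeps n D b t s { s with reg := Function.update s.reg (tp u) v } := by
  refine ⟨fun r hr => ?_, fun y hy => ?_, fun u hu => ?_, fun _ _ => rfl⟩
  · exact Function.update_of_ne (by simp only [tp]; omega) _ _
  · exact Function.update_of_ne (by simp only [vr, tp]; omega) _ _
  · exact Function.update_of_ne (by simp only [tp]; omega) _ _

theorem Keeps.update_mem {n : ℕ} {D : List ℕ} {b t : ℕ} (s : State) {c : ℕ}
    (hc : n * n + b * n ≤ c) (v : ℕ) :
    Keeps n D b t s { s with mem := Function.update s.mem c v } :=
  ⟨fun _ _ => rfl, fun _ _ => rfl, fun _ _ => rfl,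
    fun _ hc' => Function.update_of_ne (hc'.trans_le hc).ne _ _⟩

theorem add_mul_lt {n k m : ℕ} (hk : k < m) (i : Fin n) : k * n + i < m * n := by
  have h := Nat.mul_le_mul_right n (Nat.succ_le_of_lt hk)
  rw [Nat.succ_mul] at h
  omega

/-- Array `k` lives in block `2 * k`, and block `2 * k + 1` is scratch space for its next iterate.
Thus `2 * a - 1` protected blocks suffice for `a` arrays, which leaves the last scratch block
writable. -/
theorem Repr.keeps {n : ℕ} {G : SimpleGraph (Fin n)} {D : List ℕ} {a b t : ℕ} {ρ : ℕ → Fin n}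
    {A : ℕ → Fin n → ℕ} {s s' : State} (h : Repr G D a ρ A s) (hk : Keeps n D b t s s')
    (hb : 2 * a ≤ b + 1) :
    Repr G D a ρ A s' where
  size := (hk.fixed 0 (by simp)).trans h.size
  sq := (hk.fixed 1 (by simp)).trans h.sq
  adj i j := (hk.mem _ (by have := add_mul_lt i.2 j; omega)).trans (h.adj i j)
  var x hx := (hk.var x hx).trans (h.var x hx)
  arr k hk' i := (hk.mem _ (by
    have := add_mul_lt (show 2 * k < b by omega) i; omega)).trans (h.arr k hk' i)

theorem Repr.update_var {n : ℕ} {G : SimpleGraph (Fin n)} {D : List ℕ} {a : ℕ} {ρ : ℕ → Fin n}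
    {A : ℕ → Fin n → ℕ} {s : State} (h : Repr G D a ρ A s) {x : ℕ} (hx : x ∉ D) {i : Fin n}
    (hi : s.reg (vr x) = i) : Repr G (x :: D) a (Function.update ρ x i) A s where
  size := h.size
  sq := h.sq
  adj := h.adj
  var y hy := by
    by_cases hyx : y = x
    · subst hyx; simpa using hi
    · rw [Function.update_of_ne hyx]
      exact h.var y (by simpa [hyx] using hy)
  arr := h.arr

theorem Repr.update_arr {n : ℕ} {G : SimpleGraph (Fin n)} {D : List ℕ} {a : ℕ} {ρ : ℕ → Fin n}
    {A : ℕ → Fin n → ℕ} {s : State} (h : Repr G D a ρ A s) {S : Fin n → ℕ}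
    (hS : ∀ i : Fin n, s.mem (n * n + 2 * a * n + i) = S i) :
    Repr G D (a + 1) ρ (Function.update A a S) s where
  size := h.size
  sq := h.sq
  adj := h.adj
  var := h.var
  arr k hk i := by
    by_cases hka : k = a
    · subst hka; simpa using hS i
    · rw [Function.update_of_ne hka]
      exact h.arr k (by omega) i

/-- `P` runs from `s` within time `T` to a state satisfying `Q`. -/
def Runs (P : Prog) (s : State) (T : ℕ) (Q : State → Prop) : Prop :=
  ∃ t s', Exec P s t s' ∧ t ≤ T ∧ Q s'

theorem Runs.mono {P : Prog} {s : State} {T T' : ℕ} {Q Q' : State → Prop} (h : Runs P s T Q)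
    (hT : T ≤ T') (hQ : ∀ s', Q s' → Q' s') : Runs P s T' Q' := by
  obtain ⟨t, s', he, ht, hq⟩ := h
  exact ⟨t, s', he, ht.trans hT, hQ _ hq⟩

theorem Runs.seq {P P' : Prog} {s : State} {T T' : ℕ} {Q Q' : State → Prop} (h : Runs P s T Q)
    (h' : ∀ s', Q s' → Runs P' s' T' Q') : Runs (.seq P P') s (T + T') Q' := by
  obtain ⟨t, s', he, ht, hq⟩ := h
  obtain ⟨t', s'', he', ht', hq'⟩ := h' s' hq
  exact ⟨t + t', s'', .seq he he', add_le_add ht ht', hq'⟩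

theorem Runs.set {r : ℕ} {e : Expr} {s : State} {Q : State → Prop}
    (h : Q { s with reg := Function.update s.reg r (e.eval s) }) :
    Runs (.set r e) s (e.cost + 1) Q :=
  ⟨_, _, .set s r e, le_rfl, h⟩

theorem Runs.store {a e : Expr} {s : State} {Q : State → Prop}
    (h : Q { s with mem := Function.update s.mem (a.eval s) (e.eval s) }) :
    Runs (.store a e) s (a.cost + e.cost + 1) Q :=
  ⟨_, _, .store s a e, le_rfl, h⟩

/-- A loop counting down the register `r`, with an invariant depending on the counter. -/
theorem Runs.countdown {r : ℕ} {P : Prog} {T : ℕ} (I : ℕ → State → Prop)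
    (hr : ∀ m s, I m s → s.reg r = m)
    (hP : ∀ m s, I (m + 1) s →
      Runs P { s with reg := Function.update s.reg r m } T (I m)) (m : ℕ) (s : State)
    (hs : I m s) :
    Runs (.loop (.reg r) (.seq (.set r (.sub (.reg r) (.const 1))) P)) s (m * (T + 6) + 2)
      (I 0) := by
  induction m generalizing s with
  | zero =>
    exact ⟨_, _, .loop_zero (by simp [Expr.eval, hr _ _ hs]), by simp [Expr.cost], hs⟩
  | succ m ih =>
    obtain ⟨t, s', he, ht, hq⟩ := hP m s hs
    obtain ⟨t', s'', he', ht', hq'⟩ := ih s' hq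
    have h0 : s.reg r = m + 1 := hr _ _ hs
    -- The decrement costs 4 steps and the loop test 2, which together are the 6 in the bound.
    have hbody : Exec (.seq (.set r (.sub (.reg r) (.const 1))) P) s (4 + t) s' := by
      refine .seq (.set s r _) ?_
      simpa [Expr.eval, h0] using he
    refine ⟨_, s'', .loop_pos (by simp [Expr.eval, h0]) hbody he', ?_, hq'⟩
    simp only [Expr.cost]
    rw [Nat.succ_mul]
    omega

theorem Runs.forAll {n r : ℕ} {P : Prog} {T : ℕ} {s : State} (I : ℕ → State → Prop)
    (hr : ∀ m s, I m s → s.reg r = m)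
    (hP : ∀ m < n, ∀ s, I (m + 1) s →
      Runs P { s with reg := Function.update s.reg r m } T (I m))
    (hn : s.reg 0 = n) (hs : I n { s with reg := Function.update s.reg r n }) :
    Runs (forAll r P) s (n * (T + 6) + 4) (I 0) := by
  have hloop := Runs.countdown (T := T) (fun m s => m ≤ n ∧ I m s) (fun m s h => hr m s h.2)
    (fun m s h => (hP m h.1 s h.2).mono le_rfl fun s' hs' => ⟨(Nat.le_succ m).trans h.1, hs'⟩)
    n _ ⟨le_rfl, hs⟩
  have hset : Runs (.set r (.reg 0)) s 2 fun s' =>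
      s' = { s with reg := Function.update s.reg r n } :=
    Runs.set (by simp [Expr.eval, hn])
  refine (hset.seq (T' := n * (T + 6) + 2) (Q' := I 0) ?_).mono (by omega) fun s' hs' => hs'
  rintro _ rfl
  exact hloop.mono le_rfl fun s' hs' => hs'.2

theorem cost_mulN (k : ℕ) : (mulN k).cost = 2 * k + 1 := by
  induction k with
  | zero => rfl
  | succ k ih => simp only [mulN, Expr.cost, ih]; omega

theorem eval_mulN (k : ℕ) (s : State) : (mulN k).eval s = k * s.reg 0 := by
  induction k with
  | zero => simp [mulN, Expr.eval]
  | succ k ih => simp only [mulN, Expr.eval, ih, Nat.succ_mul]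

theorem cost_cell (k r : ℕ) : (cell k r).cost = 2 * k + 5 := by
  simp only [cell, Expr.cost, cost_mulN]; omega

theorem Repr.eval_cell {n : ℕ} {G : SimpleGraph (Fin n)} {D : List ℕ} {a : ℕ} {ρ : ℕ → Fin n}
    {A : ℕ → Fin n → ℕ} {s : State} (h : Repr G D a ρ A s) (k r : ℕ) :
    (cell k r).eval s = n * n + k * n + s.reg r := by
  simp only [cell, Expr.eval, eval_mulN, h.size, h.sq]

theorem tp_ne_vr (t x : ℕ) : tp t ≠ vr x := by simp only [tp, vr]; omega

theorem Runs.skip {s : State} {Q : State → Prop} (h : Q s) : Runs .skip s 1 Q :=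
  ⟨_, _, .skip s, le_rfl, h⟩

/-- `J` is a memory invariant beyond the `b` protected blocks. It is needed when block `2 * k` is
overwritten by a copy of the scratch block lying above it. -/
theorem runs_fill {n : ℕ} {G : SimpleGraph (Fin n)} {D : List ℕ} {a b t : ℕ} {ρ : ℕ → Fin n}
    {A : ℕ → Fin n → ℕ} {s : State} {P : Prog} {e : Expr} {T x : ℕ} (hs : Repr G D a ρ A s)
    (hb : 2 * a ≤ b + 1) (hx : x ∉ D) (f : Fin n → ℕ) (J : (ℕ → ℕ) → Prop) (hJ : J s.mem)
    (hJu : ∀ m, J m → ∀ (i : Fin n) v, J (Function.update m (n * n + b * n + i) v))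
    (hP : ∀ (i : Fin n) s', Keeps n D b t s s' → J s'.mem → s'.reg (vr x) = i →
      Runs P s' T fun s'' => Keeps n (x :: D) (b + 1) t s' s'' ∧ J s''.mem ∧ e.eval s'' = f i) :
    Runs (fill x b P e) s (n * (T + (2 * b + 5 + e.cost + 1) + 6) + 4)
      fun s' => Keeps n D b t s s' ∧ J s'.mem ∧
        ∀ i : Fin n, s'.mem (n * n + b * n + i) = f i := by
  refine (Runs.forAll (n := n) (fun m s' => Keeps n D b t s s' ∧ J s'.mem ∧ s'.reg (vr x) = m ∧
    ∀ i : Fin n, m ≤ i → s'.mem (n * n + b * n + i) = f i) (fun m s' h => h.2.2.1) ?_ hs.size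
    ⟨.update_var s hx n, hJ, by simp, fun i hi => absurd i.2 (not_lt.2 hi)⟩).mono le_rfl
    fun s' h => ⟨h.1, h.2.1, fun i => h.2.2.2 i (Nat.zero_le _)⟩
  rintro m hm s' ⟨hk, hJs, hr, hf⟩
  have hk' : Keeps n D b t s { s' with reg := Function.update s'.reg (vr x) m } :=
    hk.trans (.update_var s' hx m)
  refine (hP ⟨m, hm⟩ _ hk' hJs (by simp)).seq fun s'' ⟨hk'', hJ'', he⟩ => ?_
  have hkD : Keeps n D b t s s'' := hk'.trans (hk''.mono (by simp) (by simp) le_rfl)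
  have hxm : s''.reg (vr x) = m := by rw [hk''.var x (by simp)]; simp
  have haddr : (cell b (vr x)).eval s'' = n * n + b * n + m := by
    rw [(hs.keeps hkD hb).eval_cell, hxm]
  refine (Runs.store ?_).mono (by rw [cost_cell]) fun _ h => h
  rw [haddr, he]
  refine ⟨hkD.trans (.update_mem s'' (by omega) _), hJu _ hJ'' ⟨m, hm⟩ _, hxm, fun i hi => ?_⟩
  rcases Nat.lt_or_ge m i with h | h
  · dsimp only
    rw [Function.update_of_ne (by omega), ← hf i h]
    have := add_mul_lt (Nat.lt_succ_self b) i
    exact hk''.mem _ (by rw [Nat.succ_eq_add_one] at this; omega)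
  · have : i = ⟨m, hm⟩ := Fin.ext (le_antisymm h hi)
    subst this
    simp

/-- The polynomial depends on the term and its context only. A `sum` multiplies the time of its body
by about `n`, an `iter` by about `n ^ 2`. -/
theorem runs_comp (e : Tm) : ∀ (D : List ℕ) (a t : ℕ), e.wellScoped D a = true →
    ∃ p : Polynomial ℕ, ∀ (n : ℕ) (G : SimpleGraph (Fin n)) (ρ : ℕ → Fin n) (A : ℕ → Fin n → ℕ)
      (s : State), Repr G D a ρ A s → Runs (comp e t) s (p.eval n) fun s' =>
        Keeps n D (2 * a) t s s' ∧ s'.reg (tp t) = e.val G ρ A := by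
  induction e with
  | const c =>
    intro D a t _
    exact ⟨2, fun n G ρ A s _ => (Runs.set ⟨.update_tmp s le_rfl _, by simp [Expr.eval, Tm.val]⟩).mono
      (by simp [Expr.cost]) fun _ h => h⟩
  | var x =>
    intro D a t hD
    simp only [Tm.wellScoped, decide_eq_true_eq] at hD
    exact ⟨2, fun n G ρ A s hs => (Runs.set ⟨.update_tmp s le_rfl _, by
      simp [Expr.eval, Tm.val, hs.var x hD]⟩).mono (by simp [Expr.cost]) fun _ h => h⟩
  | adj x y =>
    intro D a t hD
    simp only [Tm.wellScoped, Bool.and_eq_true, decide_eq_true_eq] at hD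
    refine ⟨10 * .X + 20, fun n G ρ A s hs => ?_⟩
    have h1 : Runs (.set (tp t) (.const 0)) s 2 fun s' =>
        Keeps n D (2 * a) t s s' ∧ s'.reg (tp t) = 0 :=
      Runs.set ⟨.update_tmp s le_rfl _, by simp [Expr.eval]⟩
    refine (h1.seq (T' := 10 * n + 18) fun s₁ ⟨hk₁, ht₁⟩ => ?_).mono (by simp; omega)
      fun _ h => h
    have h2 : Runs (.set (tp (t + 1)) (.reg (vr x))) s₁ 2 fun s' =>
        Keeps n D (2 * a) t s s' ∧ s'.reg (tp t) = 0 ∧ s'.reg (tp (t + 1)) = ρ x := by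
      refine Runs.set ⟨hk₁.trans (.update_tmp _ (by omega) _), ?_, ?_⟩
      · simpa [tp] using ht₁
      · simp [Expr.eval, hk₁.var x hD.1, hs.var x hD.1]
    refine (h2.seq (T' := 10 * n + 16) fun s₂ ⟨hk₂, ht₂, hx₂⟩ => ?_).mono (by omega) fun _ h => h
    -- Without multiplication, the row offset `ρ x * n` is obtained by adding `n` repeatedly.
    have h3 := Runs.countdown (r := tp (t + 1)) (T := 4)
      (P := .set (tp t) (.add (.reg (tp t)) (.reg 0)))
      (fun m s' => Keeps n D (2 * a) t s s' ∧ s'.reg (tp (t + 1)) = m ∧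
        s'.reg (tp t) + m * n = ρ x * n) (fun m s' h => h.2.1) (fun m s' ⟨hk, hm, hsum⟩ => by
        refine Runs.set ⟨(hk.trans (.update_tmp _ (by omega) _)).trans (.update_tmp _ le_rfl _),
          by simp [tp], ?_⟩
        have h0 : s'.reg 0 = n := (hs.keeps hk (by omega)).size
        rw [Nat.succ_mul] at hsum
        simp only [Expr.eval, tp, Function.update_self] at hsum ⊢
        rw [Function.update_of_ne (by omega), Function.update_of_ne (by omega), h0]
        omega) (ρ x) s₂ ⟨hk₂, hx₂, by simp [ht₂]⟩
    have hx := (ρ x).2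
    refine (h3.seq (T' := 6) fun s₃ ⟨hk₃, _, hsum⟩ => ?_).mono (by omega) fun _ h => h
    refine (Runs.set ⟨hk₃.trans (.update_tmp _ le_rfl _), ?_⟩).mono (by simp [Expr.cost])
      fun _ h => h
    have hs₃ := hs.keeps hk₃ (by omega)
    simp only [Expr.eval, Function.update_self, hs₃.var y hD.2]
    rw [show s₃.reg (tp t) = ρ x * n by simpa using hsum, hs₃.adj]
    rfl
  | arr k x =>
    intro D a t hD
    simp only [Tm.wellScoped, Bool.and_eq_true, decide_eq_true_eq] at hD
    refine ⟨.C (4 * k + 7), fun n G ρ A s hs => (Runs.set (e := .mem (cell (2 * k) (vr x)))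
      ⟨.update_tmp s le_rfl _, ?_⟩).mono ?_ fun _ h => h⟩
    · simp only [Expr.cost, cost_cell, Polynomial.eval_C]
      omega
    · simp only [Expr.eval, Function.update_self, hs.eval_cell, hs.var x hD.2]
      exact hs.arr k hD.1 _
  | add e f ihe ihf =>
    intro D a t hD
    simp only [Tm.wellScoped, Bool.and_eq_true] at hD
    obtain ⟨p, hp⟩ := ihe D a t hD.1
    obtain ⟨q, hq⟩ := ihf D a (t + 1) hD.2
    refine ⟨p + (q + 4), fun n G ρ A s hs => ?_⟩
    refine ((hp n G ρ A s hs).seq (T' := q.eval n + 4) fun s₁ ⟨hk₁, hv₁⟩ => ?_).mono (by simp)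
      fun _ h => h
    refine (hq n G ρ A s₁ (hs.keeps hk₁ (by omega))).seq fun s₂ ⟨hk₂, hv₂⟩ => ?_
    refine (Runs.set ⟨(hk₁.trans (hk₂.mono (by simp) le_rfl (by omega))).trans
      (.update_tmp _ le_rfl _), ?_⟩).mono (by simp [Expr.cost]) fun _ h => h
    simp only [Expr.eval, Function.update_self, hv₂, hk₂.tmp t (by omega), hv₁]
    rfl
  | sub e f ihe ihf =>
    intro D a t hD
    simp only [Tm.wellScoped, Bool.and_eq_true] at hD
    obtain ⟨p, hp⟩ := ihe D a t hD.1
    obtain ⟨q, hq⟩ := ihf D a (t + 1) hD.2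
    refine ⟨p + (q + 4), fun n G ρ A s hs => ?_⟩
    refine ((hp n G ρ A s hs).seq (T' := q.eval n + 4) fun s₁ ⟨hk₁, hv₁⟩ => ?_).mono (by simp)
      fun _ h => h
    refine (hq n G ρ A s₁ (hs.keeps hk₁ (by omega))).seq fun s₂ ⟨hk₂, hv₂⟩ => ?_
    refine (Runs.set ⟨(hk₁.trans (hk₂.mono (by simp) le_rfl (by omega))).trans
      (.update_tmp _ le_rfl _), ?_⟩).mono (by simp [Expr.cost]) fun _ h => h
    simp only [Expr.eval, Function.update_self, hv₂, hk₂.tmp t (by omega), hv₁]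
    rfl
  | sum x e ih =>
    intro D a t hD
    simp only [Tm.wellScoped, Bool.and_eq_true, decide_eq_true_eq] at hD
    obtain ⟨p, hp⟩ := ih (x :: D) a (t + 1) hD.2
    refine ⟨2 + (.X * (p + 4 + 6) + 4), fun n G ρ A s hs => ?_⟩
    have h1 : Runs (.set (tp t) (.const 0)) s 2 fun s' =>
        Keeps n D (2 * a) t s s' ∧ s'.reg (tp t) = 0 :=
      Runs.set ⟨.update_tmp s le_rfl _, by simp [Expr.eval]⟩
    refine (h1.seq (T' := n * (p.eval n + 4 + 6) + 4) fun s₁ ⟨hk₁, ht₁⟩ => ?_).mono (by simp)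
      fun _ h => h
    refine (Runs.forAll (n := n) (fun m s' => Keeps n D (2 * a) t s s' ∧ s'.reg (vr x) = m ∧
      s'.reg (tp t) = ∑ i : Fin n, if m ≤ i then e.val G (Function.update ρ x i) A else 0)
      (fun m s' h => h.2.1) ?_ ((hk₁.fixed 0 (by simp)).trans hs.size) ⟨hk₁.trans
        (.update_var _ hD.1 _), by simp, ?_⟩).mono le_rfl fun s' h => ⟨h.1, by
        simpa [Tm.val] using h.2.2⟩
    · rintro m hm s₂ ⟨hk₂, hx₂, hv₂⟩
      have hk₂' := hk₂.trans (.update_var s₂ hD.1 m)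
      refine (hp n G (Function.update ρ x ⟨m, hm⟩) A _
        ((hs.keeps hk₂' (by omega)).update_var hD.1 (by simp))).seq fun s₃ ⟨hk₃, hv₃⟩ => ?_
      refine (Runs.set ⟨(hk₂'.trans (hk₃.mono (by simp) le_rfl (by omega))).trans
        (.update_tmp _ le_rfl _), ?_, ?_⟩).mono (by simp [Expr.cost]) fun _ h => h
      · dsimp only
        rw [Function.update_of_ne (tp_ne_vr _ _).symm, hk₃.var x (by simp)]
        simp
      · simp only [Expr.eval, Function.update_self, hv₃, hk₃.tmp t (by omega)]
        rw [Function.update_of_ne (tp_ne_vr _ _), hv₂, ← Finset.sum_erase_add _ _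
          (Finset.mem_univ (⟨m, hm⟩ : Fin n)), ← Finset.sum_erase_add (a := (⟨m, hm⟩ : Fin n)) _ _
          (Finset.mem_univ _)]
        simp only [le_refl, if_true, Nat.not_succ_le_self, if_false, add_zero]
        congr 1
        refine Finset.sum_congr rfl fun i hi => ?_
        have : (i : ℕ) ≠ m := fun h => (Finset.mem_erase.1 hi).1 (Fin.ext h)
        congr 1
        simp only [eq_iff_iff]
        omega
    · dsimp only
      rw [Function.update_of_ne (tp_ne_vr _ _), ht₁]
      refine (Finset.sum_eq_zero fun i _ => ?_).symm
      exact if_neg (not_le.2 i.2)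
  | iter k x f g ihf ihg =>
    intro D a t hD
    simp only [Tm.wellScoped, Bool.and_eq_true, decide_eq_true_eq] at hD
    obtain ⟨⟨⟨rfl, hx⟩, hf⟩, hg⟩ := hD
    obtain ⟨p, hp⟩ := ihf (x :: D) (k + 1) (t + 1) hf
    obtain ⟨q, hq⟩ := ihg D (k + 1) t hg
    refine ⟨(.X * (1 + .C (4 * k + 7) + 6) + 4) +
      ((.X * ((.X * (p + .C (4 * k + 9) + 6) + 4) + (.X * (1 + .C (8 * k + 14) + 6) + 4) + 6) + 4) +
      q), fun n G ρ A s hs => ?_⟩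
    have h1 := runs_fill (t := t) (P := .skip) (e := .const 0) (T := 1) (b := 2 * k) hs (by omega)
      hx (fun _ => 0) (fun _ => True) trivial (fun _ _ _ _ => trivial)
      (fun i s' _ _ _ => Runs.skip ⟨.refl _ _ _ _ _, trivial, rfl⟩)
    refine (h1.seq (T' := (n * ((n * (p.eval n + (4 * k + 9) + 6) + 4) +
      (n * (1 + (8 * k + 14) + 6) + 4) + 6) + 4) + q.eval n) fun s₁ ⟨hk₁, _, hz₁⟩ => ?_).mono
      (by simp [Expr.cost]; ring_nf; rfl) fun _ h => h
    -- Every new entry may depend on the whole old array, so the next iterate is built in the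
    -- scratch block and then copied back.
    set Φ : (Fin n → ℕ) → Fin n → ℕ := fun S i =>
      f.val G (Function.update ρ x i) (Function.update A k S) with hΦ
    have hloop := Runs.forAll (n := n) (r := tp t) (s := s₁)
      (P := .seq (fill x (2 * k + 1) (comp f (t + 1)) (.reg (tp (t + 1))))
              (fill x (2 * k) .skip (.mem (cell (2 * k + 1) (vr x)))))
      (T := (n * (p.eval n + (4 * k + 9) + 6) + 4) + (n * (1 + (8 * k + 14) + 6) + 4))
      (fun m s' => Keeps n D (2 * k) t s s' ∧ s'.reg (tp t) = m ∧
        ∀ i : Fin n, s'.mem (n * n + 2 * k * n + i) = (Φ^[n - m] fun _ => 0) i)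
      (fun m s' h => h.2.1) ?_ ((hk₁.fixed 0 (by simp)).trans hs.size)
      ⟨hk₁.trans (.update_tmp _ le_rfl _), by simp, by simpa using hz₁⟩
    · refine hloop.seq fun s₂ ⟨hk₂, _, hv₂⟩ => ?_
      refine (hq n G ρ _ s₂ ((hs.keeps hk₂ (by omega)).update_arr hv₂)).mono le_rfl
        fun s₃ ⟨hk₃, hv₃⟩ => ⟨hk₂.trans (hk₃.mono (by simp) (by omega) le_rfl), hv₃⟩
    · rintro m hm s₂ ⟨hk₂, ht₂, hv₂⟩
      have hk₂' := hk₂.trans (.update_tmp s₂ le_rfl m)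
      set s₂' : State := { s₂ with reg := Function.update s₂.reg (tp t) m } with hs₂'
      set S := Φ^[n - (m + 1)] fun _ => 0 with hS
      have hR : Repr G D (k + 1) ρ (Function.update A k S) s₂' :=
        (hs.keeps hk₂' (by omega)).update_arr hv₂
      have hfill := runs_fill (t := t + 1) (P := comp f (t + 1)) (e := .reg (tp (t + 1)))
        (T := p.eval n) (b := 2 * k + 1) hR (by omega) hx (Φ S) (fun _ => True) trivial
        (fun _ _ _ _ => trivial) (fun i s' hk' _ hi =>
          (hp n G (Function.update ρ x i) (Function.update A k S) s'
            ((hR.keeps hk' (by omega)).update_var hx hi)).mono le_rfl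
            fun s'' ⟨hk'', hv''⟩ => ⟨hk''.mono (by simp) (by omega) le_rfl, trivial, hv''⟩)
      refine (hfill.seq (T' := n * (1 + (8 * k + 14) + 6) + 4)
        fun s₃ ⟨hk₃, _, hv₃⟩ => ?_).mono (by
          simp only [Expr.cost]
          ring_nf; rfl) fun _ h => h
      have hk₃' : Keeps n D (2 * k) (t + 1) s₂' s₃ := hk₃.mono (by simp) (by omega) le_rfl
      have hRk : Repr G D k ρ A s₃ := (hs.keeps hk₂' (by omega)).keeps hk₃' (by omega)
      have hcopy := runs_fill (t := t + 1) (P := .skip) (e := .mem (cell (2 * k + 1) (vr x)))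
        (T := 1) (b := 2 * k) hRk (by omega) hx (Φ S)
        (fun m => ∀ i : Fin n, m (n * n + (2 * k + 1) * n + i) = Φ S i) hv₃
        (fun m hm i v j => by
          have := add_mul_lt (Nat.lt_succ_self (2 * k)) i
          rw [Function.update_of_ne (by rw [Nat.succ_eq_add_one] at this; omega)]
          exact hm j)
        (fun i s' hk' hJ hi => Runs.skip ⟨.refl _ _ _ _ _, hJ, by
          simp only [Expr.eval, (hRk.keeps hk' (by omega)).eval_cell, hi, hJ]⟩)
      refine hcopy.mono (by simp only [Expr.cost, cost_cell]; ring_nf; rfl)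
        fun s₄ ⟨hk₄, _, hv₄⟩ => ?_
      have hk₄' := hk₃'.trans hk₄
      refine ⟨hk₂'.trans (hk₄'.mono (by simp) le_rfl (by omega)), ?_, fun i => ?_⟩
      · rw [hk₄'.tmp t (by omega)]
        simp [hs₂']
      · rw [hv₄, hS, ← Function.iterate_succ_apply' Φ, show n - m = (n - (m + 1)) + 1 by omega]

/-- Closed terms are computed by programs in polynomial time. -/
theorem exists_outputsWithin (e : Tm) (he : e.wellScoped [] 0 = true) :
    ∃ (P : Prog) (p : Polynomial ℕ), ∀ (n : ℕ) (G : SimpleGraph (Fin n)) (ρ : ℕ → Fin n)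
      (A : ℕ → Fin n → ℕ), OutputsWithin P G (e.val G ρ A) (p.eval n) := by
  obtain ⟨p, hp⟩ := runs_comp e [] 0 0 he
  -- The prelude puts `n * n` into register `1`; its counter, register `3`, is `tp 0` and free to be
  -- overwritten later.
  refine ⟨.seq (.set 3 (.reg 0)) (.seq (.loop (.reg 3) (.seq (.set 3 (.sub (.reg 3) (.const 1)))
    (.set 1 (.add (.reg 1) (.reg 0))))) (.seq (comp e 0) (.set 0 (.reg (tp 0))))),
    2 + (.X * (4 + 6) + 2 + (p + 2)), fun n G ρ A => ?_⟩
  suffices h : Runs _ (graphInput G) _ fun s' => s'.reg 0 = e.val G ρ A by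
    obtain ⟨t, s', h1, h2, h3⟩ := h
    exact ⟨t, s', h2, h1, h3⟩
  have h1 : Runs (.set 3 (.reg 0)) (graphInput G) 2 fun s' => s'.mem = (graphInput G).mem ∧
      s'.reg 0 = n ∧ s'.reg 1 = 0 ∧ s'.reg 3 = n :=
    Runs.set (by simp [Expr.eval, graphInput])
  refine (h1.seq (T' := n * (4 + 6) + 2 + (p.eval n + 2)) fun s₁ ⟨hm, h0, h1, h3⟩ => ?_).mono
    (by simp) fun _ h => h
  have hloop := Runs.countdown (r := 3) (T := 4) (P := .set 1 (.add (.reg 1) (.reg 0)))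
    (fun m s' => s'.mem = (graphInput G).mem ∧ s'.reg 0 = n ∧ s'.reg 1 + m * n = n * n ∧
      s'.reg 3 = m) (fun m s' h => h.2.2.2) (fun m s' ⟨h1, h2, h3, h4⟩ => by
        rw [Nat.succ_mul] at h3
        refine Runs.set ⟨h1, ?_, ?_, ?_⟩ <;> simp [Expr.eval, h2]
        omega) n s₁ ⟨hm, h0, by simp [h1], h3⟩
  refine hloop.seq fun s₂ ⟨hm₂, h0₂, h1₂, _⟩ => ?_
  have hR : Repr G [] 0 ρ A s₂ := by
    refine ⟨h0₂, by simpa using h1₂, fun i j => ?_, by simp, by simp⟩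
    rw [hm₂]
    simp only [graphInput]
    congr 1
    rw [eq_iff_iff]
    constructor
    · rintro ⟨i', j', h, hadj⟩
      have hi : i' = i := by
        rcases lt_trichotomy (i' : ℕ) i with hlt | heq | hlt
        · have := add_mul_lt hlt j'; omega
        · exact Fin.ext heq
        · have := add_mul_lt hlt j; omega
      subst hi
      have : j' = j := Fin.ext (by omega)
      exact this ▸ hadj
    · exact fun h => ⟨i, j, rfl, h⟩
  refine (hp n G ρ A s₂ hR).seq fun s₃ ⟨_, hv⟩ => ?_
  exact (Runs.set (by simp [Expr.eval, hv])).mono (by simp [Expr.cost]) fun _ h => h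

end Compile

/-! ### Wide sets in terms of common-neighbourhood separators -/

section Separation

variable {V : Type*} {G : SimpleGraph V}

/-- The common neighbours of two vertices. -/
def cut (G : SimpleGraph V) (a b : V) : Set V := {y | G.Adj a y ∧ G.Adj b y}

/-- `x` and `y` are separated by fewer than `M` vertices that are the common neighbours of two
non-adjacent vertices. -/
def Sep (G : SimpleGraph V) (M : ℕ) (x y : V) : Prop :=
  ∃ a b, a ≠ b ∧ ¬ G.Adj a b ∧ (cut G a b).ncard < M ∧ x ∉ cut G a b ∧ y ∉ cut G a b ∧
    ¬ Linked G (cut G a b) x y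

/-- The vertices not separated from `u` or from `v`. -/
def block (G : SimpleGraph V) (M : ℕ) (u v : V) : Set V := {z | ¬ Sep G M z u ∧ ¬ Sep G M z v}

namespace IntervalRep

/-- A small bag between two vertices contains the common neighbourhood of two non-adjacent
vertices that is itself a bag between the two vertices. -/
theorem exists_cut_eq_bagAt [Finite V] (R : IntervalRep G) {x y : V} {z : ℝ} (hx : R.hi x < z)
    (hy : z < R.lo y) : ∃ a b z', a ≠ b ∧ ¬ G.Adj a b ∧ R.hi x < z' ∧ z' < R.lo y ∧
      cut G a b = R.bagAt z' ∧ R.bagAt z' ⊆ R.bagAt z := by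
  -- `b₀` begins first after `z`, `a` ends last before `b₀` begins, and `b` begins first after `a`
  -- ends. No interval begins or ends strictly between `hi a` and `lo b`, so those through `z'` are
  -- exactly those meeting both `a` and `b`.
  obtain ⟨b₀, hb₀, hb₀'⟩ := Set.exists_min_image {c | z < R.lo c} R.lo (Set.toFinite _) ⟨y, hy⟩
  obtain ⟨a, ha, ha'⟩ := Set.exists_max_image {c | R.hi c < R.lo b₀} R.hi (Set.toFinite _)
    ⟨x, hx.trans hb₀⟩
  obtain ⟨b, hb, hb'⟩ := Set.exists_min_image {c | R.hi a < R.lo c} R.lo (Set.toFinite _)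
    ⟨b₀, ha⟩
  simp only [Set.mem_ofPred_eq] at hb₀ hb₀' ha ha' hb hb'
  have hbb := hb' b₀ ha
  have hxa := ha' x (hx.trans hb₀)
  have hby := hb₀' y hy
  obtain ⟨z', haz, hzb⟩ := exists_between hb
  have hlo : ∀ c, R.lo c ≤ z' → R.lo c ≤ R.hi a := fun c hc => by
    by_contra! h
    exact absurd (hb' c h) (not_le.2 (hc.trans_lt hzb))
  have hhi : ∀ c, R.hi a < R.hi c → R.lo b₀ ≤ R.hi c := fun c hc => by
    by_contra! h
    exact absurd (ha' c h) (not_le.2 hc)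
  refine ⟨a, b, z', R.ne_of_lt hb, R.not_adj_of_lt hb, hxa.trans_lt haz,
    hzb.trans_le (hbb.trans hby), ?_, ?_⟩
  · ext c
    constructor
    · rintro ⟨h1, h2⟩
      exact ⟨(R.le_of_adj h1.symm).trans haz.le, hzb.le.trans (R.le_of_adj h2)⟩
    · rintro ⟨h1, h2⟩
      have h3 := hlo c h1
      have h4 := hhi c (haz.trans_le h2)
      constructor
      · refine (R.adj_iff_le ?_).2 ⟨(R.lo_lt_hi a).le.trans (haz.le.trans h2), h3⟩
        rintro rfl
        exact absurd haz (not_lt.2 h2)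
      · refine (R.adj_iff_le ?_).2 ⟨hbb.trans h4, (h3.trans hb.le).trans (R.lo_lt_hi b).le⟩
        rintro rfl
        exact absurd h3 (not_le.2 hb)
  · rintro c ⟨h1, h2⟩
    refine ⟨?_, hb₀.le.trans (hhi c (haz.trans_le h2))⟩
    by_contra! h
    exact absurd (hb₀' c h) (not_le.2 ((hlo c h1).trans_lt ha))

/-- The existence of an `M`-wide set in terms of separators and domination. -/
theorem exists_isWide_iff [Finite V] (R : IntervalRep G) {M : ℕ} (hM : 2 ≤ M) :
    (∃ A, IsWide G M A) ↔ ∃ u v, (u ≠ v ∧ ¬ G.Adj u v) ∧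
      ∀ S : Finset V, S.card < M → ¬ block G M u v ⊆ closedNbhd G (S : Set V) := by
  constructor
  · rintro ⟨A, h⟩
    obtain ⟨u, hu, v, hv, huv, -⟩ := R.exists_extreme_lt hM h.2
    refine ⟨u, v, ⟨R.ne_of_lt huv, R.not_adj_of_lt huv⟩, fun S hS hsub => h.2 S hS ?_⟩
    -- A cut of fewer than `M` vertices cannot separate two members of `A`, so `A` lies in the
    -- block.
    have hsep : ∀ z ∈ A, ∀ t ∈ A, ¬ Sep G M z t := by
      rintro z hz t ht ⟨a, b, -, -, hc, hzc, htc, hl⟩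
      exact hl (h.linked hc hz ht hzc htc)
    exact fun z hz => hsub ⟨hsep z hz u hu, hsep z hz v hv⟩
  · rintro ⟨u, v, ⟨hne, hadj⟩, hdom⟩
    wlog huv : R.hi u < R.lo v generalizing u v
    · have hcomm : block G M v u = block G M u v := by
        ext z
        exact and_comm
      exact this v u (hcomm ▸ hdom) hne.symm (fun h => hadj h.symm)
        ((R.lt_or_lt hne hadj).resolve_left huv)
    obtain ⟨x, hx, y, hy, hxy, hext⟩ := R.exists_extreme_lt hM hdom
    refine ⟨{c | R.hi x ≤ R.hi c ∧ R.lo c ≤ R.lo y}, R.isWide_of_bags hxy (fun z hz => ?_)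
      fun S hS hsub => hdom S hS (Set.Subset.trans hext hsub)⟩
    -- A small bag between the extreme members `x` and `y` of the block yields a small cut at `z'`.
    -- If `z'` is to the left of `v`, it separates `x` from `v`; otherwise it is to the right of `u`
    -- and separates `y` from `u`.
    by_contra! hzM
    obtain ⟨a, b, z', hab, hab', hxz, hzy, hcut, hsub⟩ := R.exists_cut_eq_bagAt hz.1 hz.2
    have hcard : (cut G a b).ncard < M := by
      rw [hcut]
      exact (Set.ncard_le_ncard hsub (Set.toFinite _)).trans_lt hzM
    have hl : ∀ c, R.hi c < z' → c ∉ cut G a b := by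
      intro c hc h
      rw [hcut] at h
      exact absurd h.2 (not_le.2 hc)
    have hr : ∀ c, z' < R.lo c → c ∉ cut G a b := by
      intro c hc h
      rw [hcut] at h
      exact absurd h.1 (not_le.2 hc)
    rcases lt_or_ge z' (R.lo v) with hzv | hvz
    · refine hx.2 ⟨a, b, hab, hab', hcard, hl x hxz, hr v hzv, fun h => ?_⟩
      have := h.induction (P := fun c => R.hi c < z')
        (fun _ _ hadj hd hc => R.hi_lt_of_adj hadj hc (hcut ▸ hd)) hxz
      exact absurd ((hzv.trans (R.lo_lt_hi v)).trans this) (lt_irrefl _)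
    · have huz := huv.trans_le hvz
      refine hy.1 ⟨a, b, hab, hab', hcard, hr y hzy, hl u huz, fun h => ?_⟩
      have := h.induction (P := fun c => z' < R.lo c)
        (fun _ _ hadj hd hc => R.lt_lo_of_adj hadj hc (hcut ▸ hd)) hzy
      exact absurd ((this.trans (R.lo_lt_hi u)).trans huz) (lt_irrefl _)

end IntervalRep

end Separation

/-- An increasing operation on sets reaches a fixed point after as many steps as there are
elements. -/
theorem iterate_isFixedPt {n : ℕ} {Φ : Set (Fin n) → Set (Fin n)} (hΦ : ∀ S, S ⊆ Φ S) :
    Φ (Φ^[n] ∅) = Φ^[n] ∅ := by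
  have key : ∀ m, Φ (Φ^[m] ∅) = Φ^[m] ∅ ∨ m ≤ (Φ^[m] ∅).ncard := by
    intro m
    induction m with
    | zero => exact Or.inr (Nat.zero_le _)
    | succ m ih =>
      rw [Function.iterate_succ_apply']
      by_cases h : Φ (Φ^[m] ∅) = Φ^[m] ∅
      · left; rw [h, h]
      · right
        have hlt := Set.ncard_lt_ncard (lt_of_le_of_ne (hΦ _) (Ne.symm h))
          (Set.toFinite _)
        have := ih.resolve_left h
        omega
  rcases key n with h | h
  · exact h
  · have : Φ^[n] ∅ = Set.univ := by
      refine Set.eq_of_subset_of_ncard_le (Set.subset_univ _) ?_ (Set.toFinite _)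
      simpa [Set.ncard_univ] using h
    rw [this]
    exact Set.Subset.antisymm (Set.subset_univ _) (hΦ _)

/-! ### Graph search and greedy domination -/

section Greedy

variable {n : ℕ} {G : SimpleGraph (Fin n)}

/-- One round of the search for the vertices linked to `x`. -/
def linkStep (G : SimpleGraph (Fin n)) (X : Set (Fin n)) (x : Fin n) (S : Set (Fin n)) :
    Set (Fin n) :=
  {w | w = x ∨ w ∈ S ∨ (w ∉ X ∧ ∃ c, c ∈ S ∧ G.Adj c w)}

/-- Every round of the search before it stabilises adds a vertex, so `n` rounds suffice. -/
theorem mem_iterate_linkStep (X : Set (Fin n)) (x y : Fin n) :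
    y ∈ (linkStep G X x)^[n] ∅ ↔ Linked G X x y := by
  have hfix := iterate_isFixedPt (Φ := linkStep G X x) fun S w hw => Or.inr (Or.inl hw)
  constructor
  · have : ∀ m, (linkStep G X x)^[m] ∅ ⊆ {y | Linked G X x y} := by
      intro m
      induction m with
      | zero => exact Set.empty_subset _
      | succ m ih =>
        rw [Function.iterate_succ_apply']
        rintro w (rfl | hw | ⟨hw, c, hc, hcw⟩)
        · exact Relation.ReflTransGen.refl
        · exact ih hw
        · exact (ih hc).tail ⟨hcw, hw⟩
    exact fun h => this n h
  · intro h
    refine h.induction (P := fun y => y ∈ (linkStep G X x)^[n] ∅) (fun c d hcd hd hc => ?_) ?_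
    · rw [← hfix]
      exact Or.inr (Or.inr ⟨hd, c, hc, hcd⟩)
    · rw [← hfix]
      exact Or.inl rfl

/-- `s` dominates `t`. -/
def Dom (G : SimpleGraph (Fin n)) (s t : Fin n) : Prop := s = t ∨ G.Adj s t

/-- The members of `T` that are not dominated by `S`. -/
def rest (G : SimpleGraph (Fin n)) (T S : Set (Fin n)) : Set (Fin n) :=
  {t | t ∈ T ∧ ¬ ∃ s, s ∈ S ∧ Dom G s t}

/-- `s` dominates all remaining vertices at distance at most two from some remaining vertex. -/
def Good (G : SimpleGraph (Fin n)) (T S : Set (Fin n)) (s : Fin n) : Prop :=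
  ∃ z, z ∈ rest G T S ∧ ∀ t, ¬ (t ∈ rest G T S ∧ ∃ y, Dom G y z ∧ Dom G y t) ∨ Dom G s t

/-- One round of the greedy construction of a dominating set. -/
def greedyStep (G : SimpleGraph (Fin n)) (T S : Set (Fin n)) : Set (Fin n) :=
  {s | s ∈ S ∨ (Good G T S s ∧ ¬ ∃ s', s' < s ∧ Good G T S s')}

theorem mem_closedNbhd_iff {S : Set (Fin n)} {t : Fin n} :
    t ∈ closedNbhd G S ↔ ∃ s, s ∈ S ∧ Dom G s t := by
  constructor
  · rintro (h | ⟨s, hs, h⟩)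
    · exact ⟨t, h, Or.inl rfl⟩
    · exact ⟨s, hs, Or.inr h⟩
  · rintro ⟨s, hs, rfl | h⟩
    · exact Or.inl hs
    · exact Or.inr ⟨s, hs, h⟩

/-- Take the remaining `z` that ends first and the dominator `s` of `z` that reaches farthest right.
The representation only proves existence; `Good` itself refers to the graph alone. -/
theorem IntervalRep.exists_good (R : IntervalRep G) {T S : Set (Fin n)}
    (h : (rest G T S).Nonempty) : ∃ s, Good G T S s := by
  have hDom : ∀ {s t}, Dom G s t ↔ R.lo s ≤ R.hi t ∧ R.lo t ≤ R.hi s := by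
    intro s t
    constructor
    · rintro (rfl | h)
      · exact ⟨(R.lo_lt_hi s).le, (R.lo_lt_hi s).le⟩
      · exact (R.adj_iff_le h.ne).1 h
    · exact fun h => R.eq_or_adj h.1 h.2
  obtain ⟨z, hz, hzmin⟩ := Set.exists_min_image _ R.hi (Set.toFinite _) h
  obtain ⟨s, hs, hsmax⟩ := Set.exists_max_image {s | Dom G s z} R.hi (Set.toFinite _)
    ⟨z, Or.inl rfl⟩
  refine ⟨s, z, hz, fun t => ?_⟩
  rw [or_iff_not_imp_left, not_not]
  rintro ⟨ht, y, hyz, hyt⟩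
  exact hDom.2 ⟨(hDom.1 hs).1.trans (hzmin t ht), (hDom.1 hyt).2.trans (hsmax y hyz)⟩

/-- The greedy construction comes with a packing of the same size. -/
theorem exists_packing (T : Set (Fin n)) (m : ℕ) :
    ∃ P : Set (Fin n), P.ncard = ((greedyStep G T)^[m] ∅).ncard ∧ P ⊆ T ∧
      (∀ z ∈ P, ∀ z' ∈ P, ∀ y, Dom G y z → Dom G y z' → z = z') ∧
      ∀ z ∈ P, ∀ t ∈ rest G T ((greedyStep G T)^[m] ∅), ∀ y, Dom G y z → ¬ Dom G y t := by
  induction m with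
  | zero => exact ⟨∅, by simp⟩
  | succ m ih =>
    obtain ⟨P, hcard, hPT, hP, hPr⟩ := ih
    rw [Function.iterate_succ_apply']
    set S := (greedyStep G T)^[m] ∅ with hS
    by_cases hgood : ∃ s, Good G T S s
    · obtain ⟨s, hs, hsmin⟩ := Set.exists_min_image {s | Good G T S s} id (Set.toFinite _) hgood
      have hstep : greedyStep G T S = insert s S := by
        ext x
        simp only [greedyStep, Set.mem_ofPred_eq, Set.mem_insert_iff]
        constructor
        · rintro (h | ⟨h1, h2⟩)
          · exact Or.inr h
          · exact Or.inl (le_antisymm (not_lt.1 fun hlt => h2 ⟨s, hlt, hs⟩) (hsmin x h1))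
        · rintro (rfl | h)
          · exact Or.inr ⟨hs, fun ⟨s', hlt, hs'⟩ => absurd (hsmin s' hs') (not_le.2 hlt)⟩
          · exact Or.inl h
      obtain ⟨z, hz, hzs⟩ := hs
      have hsub : ∀ t ∈ rest G T (insert s S), t ∈ rest G T S := fun t ht =>
        ⟨ht.1, fun ⟨c, hc, hct⟩ => ht.2 ⟨c, Set.mem_insert_of_mem _ hc, hct⟩⟩
      have hdom : ∀ t ∈ rest G T S, ∀ y, Dom G y z → Dom G y t → Dom G s t := fun t ht y h1 h2 =>
        (hzs t).resolve_left fun h => h ⟨ht, y, h1, h2⟩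
      have hsS : s ∉ S := fun h => hz.2 ⟨s, h, hdom z hz z (Or.inl rfl) (Or.inl rfl)⟩
      have hzP : z ∉ P := fun h => hPr z h z hz z (Or.inl rfl) (Or.inl rfl)
      rw [hstep]
      -- Every remaining vertex that shares a dominator with the witness `z` is dominated by `s`, so
      -- `z` shares none with what remains afterwards.
      refine ⟨insert z P, ?_, Set.insert_subset hz.1 hPT, ?_, ?_⟩
      · rw [Set.ncard_insert_of_notMem hzP (Set.toFinite _),
          Set.ncard_insert_of_notMem hsS (Set.toFinite _), hcard]
      · rintro x (rfl | hx) x' (rfl | hx') y h1 h2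
        · rfl
        · exact absurd h1 (hPr x' hx' x hz y h2)
        · exact absurd h2 (hPr x hx x' hz y h1)
        · exact hP x hx x' hx' y h1 h2
      · rintro x (rfl | hx) t ht y h1 h2
        · exact ht.2 ⟨s, Set.mem_insert _ _, hdom t (hsub t ht) y h1 h2⟩
        · exact hPr x hx t (hsub t ht) y h1 h2
    · have hstep : greedyStep G T S = S := by
        ext x
        simp only [greedyStep, Set.mem_ofPred_eq]
        exact ⟨fun h => h.resolve_right fun h => hgood ⟨x, h.1⟩, Or.inl⟩
      rw [hstep]
      exact ⟨P, hcard, hPT, hP, hPr⟩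

/-- The greedy construction yields a smallest dominating set. -/
theorem IntervalRep.le_ncard_greedy_iff (R : IntervalRep G) (T : Set (Fin n)) (M : ℕ) :
    M ≤ ((greedyStep G T)^[n] ∅).ncard ↔
      ∀ S : Finset (Fin n), S.card < M → ¬ T ⊆ closedNbhd G (S : Set (Fin n)) := by
  constructor
  · intro h S hS hsub
    obtain ⟨P, hcard, hPT, hP, -⟩ := exists_packing (G := G) T n
    have hex : ∀ z ∈ P, ∃ s ∈ S, Dom G s z := fun z hz => by
      simpa using mem_closedNbhd_iff.1 (hsub (hPT hz))
    -- No vertex dominates two members of the packing, so a dominating set is at least as large as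
    -- `P`.
    choose! f hf hf' using hex
    have := Set.ncard_le_ncard_of_injOn f (s := P) (t := (S : Set (Fin n))) hf
      (fun x hx y hy hxy => hP x hx y hy (f x) (hf' x hx) (hxy ▸ hf' y hy)) (Set.toFinite _)
    rw [Set.ncard_coe_finset] at this
    omega
  · intro h
    by_contra! hM
    set S := (greedyStep G T)^[n] ∅ with hS
    have hfin : S.Finite := Set.toFinite _
    refine h hfin.toFinset (by rwa [← Set.ncard_eq_toFinset_card _ hfin]) fun t ht => ?_
    rw [hfin.coe_toFinset]
    by_contra htS
    obtain ⟨s, hs, hsmin⟩ := Set.exists_min_image {s | Good G T S s} id (Set.toFinite _)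
      (R.exists_good ⟨t, ht, fun h => htS (mem_closedNbhd_iff.2 h)⟩)
    -- At the fixed point the least good vertex already belongs to `S`, yet it dominates its witness
    -- `z`, which `S` does not dominate.
    have hfix : greedyStep G T S = S := iterate_isFixedPt fun S x hx => Or.inl hx
    have hsS : s ∈ S := by
      rw [← hfix]
      exact Or.inr ⟨hs, fun ⟨s', hlt, hs'⟩ => absurd (hsmin s' hs') (not_le.2 hlt)⟩
    obtain ⟨z, hz, hzs⟩ := hs
    exact hz.2 ⟨s, hsS, (hzs z).resolve_left fun h => h ⟨hz, z, Or.inl rfl, Or.inl rfl⟩⟩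

end Greedy


/-! ### The width as a term -/

namespace Tm

/-- Negation. -/
def neg (e : Tm) : Tm := .sub (.const 1) e

/-- Conjunction. -/
def and (e f : Tm) : Tm := neg (.add (neg e) (neg f))

/-- Equality of two variables. -/
def eqv (x y : ℕ) : Tm := neg (.add (.sub (.var x) (.var y)) (.sub (.var y) (.var x)))

/-- The number of values of a variable for which a term is nonzero. -/
def count (x : ℕ) (e : Tm) : Tm := .sum x (neg (neg e))

section

variable {n : ℕ} (G : SimpleGraph (Fin n))

/-- A term holds if its value is nonzero. -/
def Holds (e : Tm) (ρ : ℕ → Fin n) (A : ℕ → Fin n → ℕ) : Prop := e.val G ρ A ≠ 0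

variable {G} {ρ : ℕ → Fin n} {A : ℕ → Fin n → ℕ} {e f : Tm} {x y k : ℕ}

theorem holds_neg : (neg e).Holds G ρ A ↔ ¬ e.Holds G ρ A := by
  simp only [Holds, neg, val]; omega

theorem holds_and : (and e f).Holds G ρ A ↔ e.Holds G ρ A ∧ f.Holds G ρ A := by
  simp only [Holds, and, neg, val]; omega

theorem holds_add : (add e f).Holds G ρ A ↔ e.Holds G ρ A ∨ f.Holds G ρ A := by
  simp only [Holds, val]; omega

theorem holds_sub : (sub e f).Holds G ρ A ↔ f.val G ρ A < e.val G ρ A := by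
  simp only [Holds, val]; omega

theorem holds_eqv : (eqv x y).Holds G ρ A ↔ ρ x = ρ y := by
  simp only [Holds, eqv, neg, val, Fin.ext_iff]; omega

theorem holds_adj : (adj x y).Holds G ρ A ↔ G.Adj (ρ x) (ρ y) := by
  simp [Holds, val]

theorem holds_arr : (arr k x).Holds G ρ A ↔ A k (ρ x) ≠ 0 := Iff.rfl

theorem holds_sum : (sum x e).Holds G ρ A ↔ ∃ i, e.Holds G (Function.update ρ x i) A := by
  simp [Holds, val]

theorem val_count : (count x e).val G ρ A = {i | e.Holds G (Function.update ρ x i) A}.ncard := by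
  classical
  rw [Set.ncard_eq_toFinset_card', Set.toFinset_ofPred, Finset.card_filter]
  simp only [count, neg, val]
  refine Finset.sum_congr rfl fun i _ => ?_
  split_ifs with h
  · simp only [Holds] at h; omega
  · simp only [Holds, not_not] at h; omega

/-- Iteration computes the iterates of an operation on sets. -/
theorem exists_val_iter {Φ : Set (Fin n) → Set (Fin n)}
    (h : ∀ S : Fin n → ℕ, {i | e.Holds G (Function.update ρ x i) (Function.update A k S)} =
      Φ {i | S i ≠ 0}) : ∃ S : Fin n → ℕ, {i | S i ≠ 0} = Φ^[n] ∅ ∧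
      (iter k x e f).val G ρ A = f.val G ρ (Function.update A k S) := by
  refine ⟨_, ?_, rfl⟩
  have hsemi : Function.Semiconj (fun S : Fin n → ℕ => {i | S i ≠ 0})
      (fun S i => e.val G (Function.update ρ x i) (Function.update A k S)) Φ := h
  have := (hsemi.iterate_right n) fun _ => 0
  simpa using this

end

/-- `Sep`, where the number of vertices is bounded by the variable `0`. -/
def sep (x y : ℕ) : Tm :=
  .sum 10 (.sum 11 (and (and (neg (eqv 10 11)) (neg (.adj 10 11)))
    (and (.sub (.var 0) (count 12 (and (.adj 10 12) (.adj 11 12))))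
      (and (and (neg (and (.adj 10 x) (.adj 11 x))) (neg (and (.adj 10 y) (.adj 11 y))))
        (neg (.iter 1 13
          (.add (eqv 13 x) (.add (.arr 1 13)
            (and (neg (and (.adj 10 13) (.adj 11 13))) (.sum 14 (and (.arr 1 14) (.adj 14 13))))))
          (.arr 1 y)))))))

/-- `block`, with the variables `1` and `2`. -/
def block (x : ℕ) : Tm := and (neg (sep x 1)) (neg (sep x 2))

/-- `Dom`. -/
def dom (x y : ℕ) : Tm := .add (eqv x y) (.adj x y)

/-- `rest`, relative to the array `0`. -/
def rest (x : ℕ) : Tm := and (block x) (neg (.sum 7 (and (.arr 0 7) (dom 7 x))))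

/-- `Good`, relative to the array `0`. -/
def good (x : ℕ) : Tm :=
  .sum 4 (and (rest 4) (neg (.sum 5 (neg
    (.add (neg (and (rest 5) (.sum 6 (and (dom 6 4) (dom 6 5))))) (dom x 5))))))

/-- The size of the greedy dominating set. -/
def greedy : Tm :=
  .iter 0 3 (.add (.arr 0 3) (and (good 3) (neg (.sum 8 (and (.sub (.var 3) (.var 8)) (good 8))))))
    (count 3 (.arr 0 3))

/-- The width. -/
def width : Tm :=
  .add (.const 1) (count 0 (and (.sub (.var 0) (.const 1))
    (.sum 1 (.sum 2 (and (and (neg (eqv 1 2)) (neg (.adj 1 2)))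
      (.sub (.add greedy (.const 1)) (.var 0)))))))

section

variable {n : ℕ} {G : SimpleGraph (Fin n)} {ρ : ℕ → Fin n} {A : ℕ → Fin n → ℕ} {x y : ℕ}

/-- The bounds keep `x` and `y` clear of the bound variables `10` to `14`. -/
theorem holds_sep (hx : x < 10) (hy : y < 10) :
    (sep x y).Holds G ρ A ↔ Sep G (ρ 0) (ρ x) (ρ y) := by
  have hx' : ∀ k, 10 ≤ k → x ≠ k := fun k hk => by omega
  have hy' : ∀ k, 10 ≤ k → y ≠ k := fun k hk => by omega
  simp only [sep, holds_sum, Sep]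
  refine exists_congr fun a => exists_congr fun b => ?_
  obtain ⟨S, hS, hval⟩ := exists_val_iter (G := G) (k := 1) (x := 13)
    (ρ := Function.update (Function.update ρ 10 a) 11 b) (A := A) (f := .arr 1 y)
    (e := .add (eqv 13 x) (.add (.arr 1 13)
            (and (neg (and (.adj 10 13) (.adj 11 13))) (.sum 14 (and (.arr 1 14) (.adj 14 13))))))
    (Φ := linkStep G (cut G a b) (ρ x)) (fun S => by
      ext w
      simp [holds_add, holds_and, holds_neg, holds_eqv, holds_adj, holds_arr, holds_sum,
        linkStep, cut, hx'])
  have hlink : (iter 1 13 (.add (eqv 13 x) (.add (.arr 1 13)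
      (and (neg (and (.adj 10 13) (.adj 11 13))) (.sum 14 (and (.arr 1 14) (.adj 14 13))))))
      (.arr 1 y)).Holds G (Function.update (Function.update ρ 10 a) 11 b) A ↔
      Linked G (cut G a b) (ρ x) (ρ y) := by
    rw [← mem_iterate_linkStep, ← hS, Holds, hval]
    simp [val, hy']
  simp only [holds_and, holds_neg, hlink, holds_sub, holds_eqv, holds_adj, val_count, val]
  simp [hx', hy', cut, and_assoc]

theorem holds_block (hx : x < 10) :
    (block x).Holds G ρ A ↔ ρ x ∈ InfiniteSpeed.block G (ρ 0) (ρ 1) (ρ 2) := by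
  simp only [block, holds_and, holds_neg, holds_sep hx (show 1 < 10 by simp),
    holds_sep hx (show 2 < 10 by simp)]
  rfl

theorem holds_dom : (dom x y).Holds G ρ A ↔ Dom G (ρ x) (ρ y) := by
  simp only [dom, holds_add, holds_eqv, holds_adj, Dom]

theorem holds_rest (hx : x < 10) (hx' : x ≠ 7) : (rest x).Holds G ρ A ↔
    ρ x ∈ InfiniteSpeed.rest G (InfiniteSpeed.block G (ρ 0) (ρ 1) (ρ 2)) {i | A 0 i ≠ 0} := by
  simp [rest, holds_and, holds_neg, holds_block hx, holds_sum, holds_dom, holds_arr,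
    InfiniteSpeed.rest, hx']

theorem holds_good (hx : x = 3 ∨ x = 8) : (good x).Holds G ρ A ↔
    Good G (InfiniteSpeed.block G (ρ 0) (ρ 1) (ρ 2)) {i | A 0 i ≠ 0} (ρ x) := by
  have h4 : x ≠ 4 := by omega
  have h5 : x ≠ 5 := by omega
  simp only [good, holds_and, holds_neg, holds_add, holds_sum, holds_dom, not_exists, not_not,
    holds_rest (show 4 < 10 by simp) (by simp), holds_rest (show 5 < 10 by simp) (by simp), Good]
  simp [h4, h5]

theorem val_greedy : greedy.val G ρ A =
    ((greedyStep G (InfiniteSpeed.block G (ρ 0) (ρ 1) (ρ 2)))^[n] ∅).ncard := by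
  obtain ⟨S, hS, hval⟩ := exists_val_iter (G := G) (k := 0) (x := 3) (ρ := ρ) (A := A)
    (f := count 3 (.arr 0 3))
    (e := .add (.arr 0 3) (and (good 3) (neg (.sum 8 (and (.sub (.var 3) (.var 8)) (good 8))))))
    (Φ := greedyStep G (InfiniteSpeed.block G (ρ 0) (ρ 1) (ρ 2))) (fun S => by
      ext w
      simp [holds_add, holds_and, holds_neg, holds_arr, holds_sum, holds_sub, val,
        holds_good, greedyStep])
  rw [greedy, hval, ← hS, val_count]
  simp [holds_arr]

/-- The term `width` computes the width. -/
theorem val_width (R : IntervalRep G) [Nonempty (Fin n)] : width.val G ρ A = R.w := by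
  have hiff : ∀ M : Fin n, (and (.sub (.var 0) (.const 1))
      (.sum 1 (.sum 2 (and (and (neg (eqv 1 2)) (neg (.adj 1 2)))
        (.sub (.add greedy (.const 1)) (.var 0)))))).Holds G (Function.update ρ 0 M) A ↔
      2 ≤ (M : ℕ) ∧ (M : ℕ) ≤ R.w := by
    intro M
    simp only [holds_and, holds_sub, val, Function.update_self]
    refine and_congr_right fun hM => ?_
    rw [R.le_w_iff, R.exists_isWide_iff hM]
    simp only [holds_sum, holds_and, holds_neg, holds_eqv, holds_adj, holds_sub, val, val_greedy,
      Nat.lt_succ_iff, R.le_ncard_greedy_iff]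
    simp
  simp only [width, val, val_count, hiff]
  have h1 : 1 ≤ R.w := by
    obtain ⟨a, b, -, h⟩ := R.exists_isWide_one
    exact R.le_w_iff.2 ⟨_, h⟩
  -- The term counts the `M` from `2` to `R.w` and adds one for `M = 1`. As `M` ranges over `Fin n`,
  -- nothing is lost only because an `R.w`-wide set with `R.w ≥ 2` has more than `R.w` vertices.
  have hn : 2 ≤ R.w → R.w < n := fun h2 => by
    obtain ⟨A, hA⟩ := R.le_w_iff.1 le_rfl
    refine (hA.1.1.resolve_left (by omega)).trans_le ?_
    simpa using Nat.card_le_card_of_injective (Subtype.val : A → Fin n) Subtype.val_injective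
  have hcard : {i : Fin n | 2 ≤ (i : ℕ) ∧ (i : ℕ) ≤ R.w}.ncard = (Finset.Icc 2 R.w).card := by
    rw [← Set.ncard_coe_finset, ← Set.ncard_image_of_injective _ Fin.val_injective]
    congr 1
    ext m
    simp only [Set.mem_image, Set.mem_ofPred_eq, Finset.coe_Icc, Set.mem_Icc]
    constructor
    · rintro ⟨i, hi, rfl⟩
      exact hi
    · intro hm
      exact ⟨⟨m, hm.2.trans_lt (hn (hm.1.trans hm.2))⟩, hm, rfl⟩
  rw [hcard, Nat.card_Icc]
  omega

end

end Tm

end InfiniteSpeed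

theorem mainTheorem4 :
    ∃ (P : InfiniteSpeed.Prog) (p : Polynomial ℕ),
      ∀ (n : ℕ) (G : SimpleGraph (Fin n)), G.Connected → InfiniteSpeed.IsIntervalGraph G →
        ∃ out : ℕ,
          InfiniteSpeed.OutputsWithin P G out (p.eval n) ∧
          InfiniteSpeed.copNumber G ≤ out ∧ out ≤ 3 * InfiniteSpeed.copNumber G ∧
          Nonempty (InfiniteSpeed.IntervalRep G) ∧
          ∀ R : InfiniteSpeed.IntervalRep G,
            out = 3 * R.w ∧
            R.w ≤ InfiniteSpeed.copNumber G ∧ InfiniteSpeed.copNumber G ≤ 3 * R.w := by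
  obtain ⟨P, p, hP⟩ := InfiniteSpeed.Compile.exists_outputsWithin
    (.add InfiniteSpeed.Tm.width (.add InfiniteSpeed.Tm.width InfiniteSpeed.Tm.width)) (by decide)
  refine ⟨P, p, fun n G hG hI => ?_⟩
  have := hG.nonempty
  obtain ⟨R₀⟩ := hI.nonempty_intervalRep
  -- One value, defined from the graph alone, equals `3 * R.w` for every representation.
  have hval : ∀ R : InfiniteSpeed.IntervalRep G,
      InfiniteSpeed.Tm.val G (.add InfiniteSpeed.Tm.width (.add InfiniteSpeed.Tm.width
        InfiniteSpeed.Tm.width)) (fun _ => Classical.arbitrary _) (fun _ _ => 0) = 3 * R.w := by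
    intro R
    simp only [InfiniteSpeed.Tm.val, InfiniteSpeed.Tm.val_width R]
    omega
  refine ⟨_, hP n G (fun _ => Classical.arbitrary _) (fun _ _ => 0), ?_, ?_, ⟨R₀⟩, fun R =>
    ⟨hval R, R.w_le_copNumber, R.copNumber_le hG⟩⟩
  · rw [hval R₀]
    exact R₀.copNumber_le hG
  · rw [hval R₀]
    exact Nat.mul_le_mul_left 3 R₀.w_le_copNumber
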